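/- Let $V$ be a finite set and $\mathcal G=(V,E)$ a directed acyclic graph, with $\mathrm{pa}(v)$ the set of parents of $v$. Let $\alpha,s>0$ and put $\mathbb E_V=[0,\infty)^V\setminus\{\mathbf 0\}$. On a probability space let $(\theta_v)_{v\in V}$ be i.i.d. uniform on $[0,1]$, and let $\boldsymbol\zeta=(\zeta_v)_{v\in V}$ be nonnegative random variables, independent of $(\theta_v)_{v\in V}$ as a vector, such that $P(\zeta_v>x)\sim s x^{-\alpha}$ for every $v$ and $P(\zeta_u>x\mid\zeta_v>x)\to0$ for all $u\ne v$, as $x\to\infty$. Let $g_v:[0,\infty)^{\mathrm{pa}(v)}\times[0,\infty)\times[0,1]\to[0,\infty)$ be measurable functions and let $\mathbf X=(X_v)_{v\in V}$ be a random vector in $[0,\infty)^V$ with $$X_v=g_v(\mathbf X_{\mathrm{pa}(v)},\zeta_v,\theta_v)\quad\text{a.s.},\qquad v\in V .$$ Assume that for every $v\in V$: 1. There is a measurable function $f_v^*:[0,\infty)^{\mathrm{pa}(v)}\times[0,\infty)\times[0,1]\to[0,\infty)$ with $f_v^*(\mathbf 0,0,\theta)=0$ for all $\theta\in[0,1]$,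 such that for every $\theta\in[0,1]$, whenever $\mathbf x(t)\to\mathbf y$ in $[0,\infty)^{\mathrm{pa}(v)}$ and $z(t)\to\eta$ in $[0,\infty)$ as $t\to\infty$, we have $t^{-1}g_v(t\mathbf x(t),t z(t),\theta)\to f_v^*(\mathbf y,\eta,\theta)$. 2. There is a measurable $C_v:[0,1]\to[0,\infty)$ with $\int_0^1 C_v(r)^\alpha\,dr<\infty$ and $g_v(\mathbf X_{\mathrm{pa}(v)},\zeta_v,\theta_v)\le C_v(\theta_v)\,\|(\mathbf X_{\mathrm{pa}(v)},\zeta_v)\|$ a.s., where $\|\cdot\|$ is any fixed norm. 3. $P(X_v>0)>0$. Then $f_v^*(c\mathbf y,c\eta,\theta)=c f_v^*(\mathbf y,\eta,\theta)$ for all $v\in V$, $c\ge0$, $\mathbf y\in[0,\infty)^{\mathrm{pa}(v)}$, $\eta\ge0$ and $\theta\in[0,1]$. Furthermore, let $\Lambda^\perp$ be the measure on $\mathbb E_V$ that is concentrated on the points with exactly one positive coordinate and satisfies $\Lambda^\perp(y_v>y)=s y^{-\alpha}$ for all $y>0$ and $v\in V$. On any measure space $(\Omega',\mu)$ let $\boldsymbol\eta:\Omega'\to\mathbb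 E_V$ and $\boldsymbol\theta':\Omega'\to[0,1]^V$ be measurable maps such that the push-forward of $\mu$ under $(\boldsymbol\eta,\boldsymbol\theta')$ is $\Lambda^\perp\otimes\mathrm{Unif}[0,1]^{\otimes V}$, let $\mathbf Y$ be the solution of the extremal structural equations $Y_v=f_v^*(\mathbf Y_{\mathrm{pa}(v)},\eta_v,\theta'_v)$, $v\in V$, and let $\mathcal L(\mathbf Y)$ be the restriction to $\mathbb E_V$ of the push-forward $\mu(\mathbf Y\in\cdot)$. Then $\mathcal L(\mathbf Y)$ is finite on Borel sets separated from $\mathbf 0$, and, as $t\to\infty$, $$t\,P\bigl(t^{-1/\alpha}\mathbf X\in\cdot\bigr)\ \xrightarrow{\ v\ }\ \mathcal L(\mathbf Y)\quad\text{vaguely on }\mathbb E_V,$$ that is, the integrals of every bounded continuous function on $\mathbb E_V$ whose support is separated from $\mathbf 0$ converge. -/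

import Mathlib

open MeasureTheory ProbabilityTheory Filter Topology Asymptotics
open scoped NNReal ENNReal unitInterval BoundedContinuousFunction

namespace ExtremalSCM

/-- A directed acyclic graph on the node set `V`; `Adj u v` is the edge `u → v`. -/
structure DAG (V : Type*) where
  Adj : V → V → Prop
  acyclic : ∀ v, ¬ Relation.TransGen Adj v v

/-- The parents `pa(v)` of a node. -/
def DAG.pa {V : Type*} (G : DAG V) (v : V) : Set V := {u | G.Adj u v}

/-- Nonnegative structural functions along the DAG: the function attached to `v` takes
`(x_{pa(v)}, z, θ) ∈ [0,∞)^{pa(v)} × [0,∞) × [0,1]` to a number in `[0,∞)`. -/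
abbrev StructFun {V : Type*} (G : DAG V) : Type _ :=
  (v : V) → (G.pa v → ℝ≥0) × ℝ≥0 × I → ℝ≥0

/-- The punctured orthant `[0,∞)^V ∖ {0}`. -/
abbrev Punctured (V : Type*) : Type _ := {y : V → ℝ≥0 // y ≠ 0}

/-- The restriction of a measure on `[0,∞)^V` to the punctured orthant. -/
noncomputable def puncture {V : Type*} (m : Measure (V → ℝ≥0)) : Measure (Punctured V) :=
  m.comap Subtype.val

/-- A subset of the punctured orthant is separated from the origin if the origin is not in its
closure in `[0,∞)^V`. -/
def SeparatedFromZero {V : Type*} (B : Set (Punctured V)) : Prop :=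
  (0 : V → ℝ≥0) ∉ closure (Subtype.val '' B)

/-- Finite on every Borel set separated from the origin. -/
def BoundedlyFinite {V : Type*} (m : Measure (Punctured V)) : Prop :=
  ∀ B : Set (Punctured V), MeasurableSet B → SeparatedFromZero B → m B < ∞

/-- Vague convergence on the punctured orthant, where the bounded sets are those separated from
the origin: all the measures are boundedly finite, and the integrals of all bounded continuous
functions with support separated from the origin converge. -/
def VagueTendsto {V ι : Type*} (m : ι → Measure (Punctured V)) (l : Filter ι)
    (m₀ : Measure (Punctured V)) : Prop :=
  (∀ i, BoundedlyFinite (m i)) ∧ BoundedlyFinite m₀ ∧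
    ∀ H : Punctured V →ᵇ ℝ, SeparatedFromZero (Function.support H) →
      Tendsto (fun i => ∫ y, H y ∂(m i)) l (𝓝 (∫ y, H y ∂m₀))

/-- The improper Pareto measure, with density `s α y^(-α-1)` on `(0,∞)`, so that `(y, ∞)` has mass
`s y^(-α)` for `y > 0`. -/
noncomputable def improperPareto (α s : ℝ) : Measure ℝ≥0 :=
  ((volume.restrict (Set.Ioi 0)).withDensity
    fun y : ℝ => ENNReal.ofReal (s * α * y ^ (-α - 1))).map Real.toNNReal

/-- The extremally independent exponent measure `Λ^⊥`: it lives on the open coordinate half-axes,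
and on each of them it is the improper Pareto measure. -/
noncomputable def lambdaPerp (V : Type*) [Fintype V] [DecidableEq V] (α s : ℝ) :
    Measure (Punctured V) :=
  puncture (Measure.sum fun v : V => (improperPareto α s).map fun y => Pi.single v y)

/-- The law of i.i.d. uniform variables on `[0,1]` indexed by `V`. -/
noncomputable def uniformLaw (V : Type*) [Fintype V] : Measure (V → I) :=
  Measure.pi fun _ => (volume : Measure I)

/-- An extremal structural causal model with total structural functions `f`:
the equations `Y_v = f_v (Y_{pa(v)}, η_v, θ_v)` on a measure space
`(Ω, μ)`, where `(η, θ)` has law `Λ^⊥ ⊗ P_θ` under `μ`. -/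
structure ESCM {V : Type*} [Fintype V] [DecidableEq V] (G : DAG V) (α s : ℝ) (f : StructFun G)
    {Ω : Type*} [MeasurableSpace Ω] (μ : Measure Ω) where
  η : Ω → Punctured V
  θ : Ω → V → I
  Y : Ω → V → ℝ≥0
  measurable_η : Measurable η
  measurable_θ : Measurable θ
  measurable_Y : Measurable Y
  law_eq : μ.map (fun ω => (η ω, θ ω)) = (lambdaPerp V α s).prod (uniformLaw V)
  structural : ∀ ω v, Y ω v = f v (fun u => Y ω u, (η ω).1 v, θ ω v)

/-- The law `𝓛(Y)`: the push-forward `μ (Y ∈ ·)` restricted to the punctured orthant. -/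
noncomputable def ESCM.law {V : Type*} [Fintype V] [DecidableEq V] {G : DAG V} {α s : ℝ}
    {f : StructFun G} {Ω : Type*} [MeasurableSpace Ω] {μ : Measure Ω} (M : ESCM G α s f μ) :
    Measure (Punctured V) :=
  puncture (μ.map M.Y)

/-- `g` is asymptotically homogeneous with limit `f`. -/
def AsympHomogeneous {V : Type*} {G : DAG V} (g f : StructFun G) : Prop :=
  ∀ (v : V) (θ : I),
    f v (0, 0, θ) = 0 ∧
    ∀ (x : ℝ≥0 → G.pa v → ℝ≥0) (y : G.pa v → ℝ≥0) (z : ℝ≥0 → ℝ≥0) (η : ℝ≥0),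
      Tendsto x atTop (𝓝 y) → Tendsto z atTop (𝓝 η) →
      Tendsto (fun t : ℝ≥0 => t⁻¹ * g v (t • x t, t * z t, θ)) atTop (𝓝 (f v (y, η, θ)))

/-- The axis tails of `Λ^⊥`. -/
theorem lambdaPerp_tail {V : Type*} [Fintype V] [DecidableEq V] {α s : ℝ} (hα : 0 < α)
    (hs : 0 < s) (v : V) {y : ℝ≥0} (hy : 0 < y) :
    lambdaPerp V α s {p | y < p.1 v} = ENNReal.ofReal (s * (y : ℝ) ^ (-α)) := by
  have hemb : MeasurableEmbedding (Subtype.val : Punctured V → V → ℝ≥0) :=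
    MeasurableEmbedding.subtype_coe (measurableSet_singleton (0 : V → ℝ≥0)).compl
  have himg : Subtype.val '' {p : Punctured V | y < p.1 v} = {p : V → ℝ≥0 | y < p v} := by
    ext p
    constructor
    · rintro ⟨q, hq, rfl⟩
      exact hq
    · intro hp
      refine ⟨⟨p, ?_⟩, hp, rfl⟩
      rintro rfl
      exact absurd hp (by simp)
  have hmeas : MeasurableSet {p : V → ℝ≥0 | y < p v} :=
    measurableSet_lt measurable_const (measurable_pi_apply v)
  have hsing : ∀ u : V, Measurable fun r : ℝ≥0 => (Pi.single u r : V → ℝ≥0) := fun u =>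
    (continuous_single u).measurable
  rw [lambdaPerp, puncture, hemb.comap_apply, himg, Measure.sum_apply _ hmeas, tsum_fintype,
    Finset.sum_eq_single v]
  · rw [Measure.map_apply (hsing v) hmeas]
    have h1 : (fun r : ℝ≥0 => (Pi.single v r : V → ℝ≥0)) ⁻¹' {p | y < p v} = Set.Ioi y := by
      ext r
      simp
    have h2 : Real.toNNReal ⁻¹' Set.Ioi y = Set.Ioi (y : ℝ) := by
      ext r
      simp [Real.lt_toNNReal_iff_coe_lt]
    rw [h1, improperPareto, Measure.map_apply measurable_real_toNNReal measurableSet_Ioi, h2,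
      withDensity_apply _ measurableSet_Ioi, Measure.restrict_restrict measurableSet_Ioi]
    have hy' : (0 : ℝ) < y := hy
    have h3 : Set.Ioi (y : ℝ) ∩ Set.Ioi 0 = Set.Ioi (y : ℝ) := by
      ext r
      simp only [Set.mem_inter_iff, Set.mem_Ioi]
      exact ⟨fun h => h.1, fun h => ⟨h, hy'.trans h⟩⟩
    rw [h3, ← ofReal_integral_eq_lintegral_ofReal]
    · rw [integral_const_mul, integral_Ioi_rpow_of_lt (by linarith) hy']
      congr 1
      have : -α - 1 + 1 = -α := by ring
      rw [this]
      field_simp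
    · exact (integrableOn_Ioi_rpow_of_lt (by linarith) hy').const_mul _
    · refine (ae_restrict_mem measurableSet_Ioi).mono fun r hr => ?_
      have hr' : (0 : ℝ) < r := hy'.trans hr
      positivity
  · intro u _ hu
    rw [Measure.map_apply (hsing u) hmeas]
    have : (fun r : ℝ≥0 => (Pi.single u r : V → ℝ≥0)) ⁻¹' {p | y < p v} = ∅ := by
      ext r
      simp [Pi.single_eq_of_ne hu.symm]
    rw [this, measure_empty]
  · simp

/-- `Λ^⊥` gives no mass to points with two positive coordinates. -/
theorem lambdaPerp_offAxes {V : Type*} [Fintype V] [DecidableEq V] {α s : ℝ} {u v : V}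
    (huv : u ≠ v) : lambdaPerp V α s {p | 0 < p.1 u ∧ 0 < p.1 v} = 0 := by
  have hemb : MeasurableEmbedding (Subtype.val : Punctured V → V → ℝ≥0) :=
    MeasurableEmbedding.subtype_coe (measurableSet_singleton (0 : V → ℝ≥0)).compl
  have hpos : ∀ w : V, MeasurableSet {p : V → ℝ≥0 | 0 < p w} := fun w =>
    measurableSet_lt measurable_const (measurable_pi_apply w)
  have hmeas : MeasurableSet {p : V → ℝ≥0 | 0 < p u ∧ 0 < p v} := (hpos u).inter (hpos v)
  rw [lambdaPerp, puncture, hemb.comap_apply]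
  refine measure_mono_null (t := {p : V → ℝ≥0 | 0 < p u ∧ 0 < p v}) ?_ ?_
  · rintro _ ⟨q, hq, rfl⟩
    exact hq
  rw [Measure.sum_apply _ hmeas, ENNReal.tsum_eq_zero]
  intro w
  rw [Measure.map_apply (continuous_single w).measurable hmeas]
  have : (fun r : ℝ≥0 => (Pi.single w r : V → ℝ≥0)) ⁻¹' {p | 0 < p u ∧ 0 < p v} = ∅ := by
    ext r
    by_cases h : u = w
    · subst h
      simp [Pi.single_eq_of_ne huv.symm]
    · simp [Pi.single_eq_of_ne h]
  rw [this, measure_empty]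

/-- The extremal structural equations have a measurable solution on the canonical space. -/
theorem ESCM.exists_canonical {V : Type*} [Fintype V] [DecidableEq V] (G : DAG V) (α s : ℝ)
    (f : StructFun G) (hf : ∀ v, Measurable (f v)) :
    Nonempty (ESCM G α s f ((lambdaPerp V α s).prod (uniformLaw V))) := by
  have hirr : Std.Irrefl (Relation.TransGen G.Adj) := ⟨G.acyclic⟩
  have hwf : WellFounded G.Adj :=
    Subrelation.wf (fun h => Relation.TransGen.single h)
      (Finite.wellFounded_of_trans_of_irrefl (Relation.TransGen G.Adj))
  let Y : (v : V) → Punctured V × (V → I) → ℝ≥0 :=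
    hwf.fix fun v ih ω => f v (fun u : G.pa v => ih u.1 u.2 ω, ω.1.1 v, ω.2 v)
  have hY : ∀ v ω, Y v ω = f v (fun u => Y u ω, ω.1.1 v, ω.2 v) := fun v ω => by
    have := hwf.fix_eq (C := fun _ => Punctured V × (V → I) → ℝ≥0)
      (fun v ih ω => f v (fun u : G.pa v => ih u.1 u.2 ω, ω.1.1 v, ω.2 v)) v
    exact congrFun this ω
  have hYm : ∀ v, Measurable (Y v) := fun v => by
    induction v using hwf.induction with
    | _ v ih =>
      have h1 : Measurable fun ω : Punctured V × (V → I) =>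
          ((fun u : G.pa v => Y u ω, ω.1.1 v, ω.2 v) : (G.pa v → ℝ≥0) × ℝ≥0 × I) :=
        (measurable_pi_lambda _ fun u : G.pa v => ih u.1 u.2).prodMk
          (((measurable_pi_apply v).comp (measurable_subtype_coe.comp measurable_fst)).prodMk
            ((measurable_pi_apply v).comp measurable_snd))
      have h2 : Y v = fun ω => f v (fun u => Y u ω, ω.1.1 v, ω.2 v) := funext (hY v)
      rw [h2]
      exact (hf v).comp h1
  exact ⟨{ η := Prod.fst
           θ := Prod.snd
           Y := fun ω v => Y v ω
           measurable_η := measurable_fst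
           measurable_θ := measurable_snd
           measurable_Y := measurable_pi_lambda _ hYm
           law_eq := Measure.map_id
           structural := fun ω v => hY v ω }⟩

end ExtremalSCM

/-! Almost surely `X = g.solve ζ θ`, the recursive solution along the DAG. Freeze the noise at `θ =
r`. Asymptotic homogeneity composes along the DAG, so `t⁻¹ • g.solve (t • z') r` tends to `f.solve z
r` as `t → ∞` and `z' → z` jointly (`AsympHomogeneous.tendsto_solve`). Meanwhile `t⁻¹ • ζ`, weighted
by `t ^ α`, concentrates on the coordinate axes: two coordinates of order `t` have joint probability
`o(t ^ (-α))`, and each one alone has a Pareto limit. A continuous mapping argument with varying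
maps (`AxisTails.tendsto_integral`) then gives the limit for frozen noise.

The limit measure has infinite mass near the origin, so small innovations must not produce large
`X`. Domination, iterated along the DAG, gives `X v ≤ D θ * max ζ`, where `D` is a product of
functions of the separate `θ v` and has a finite moment of order `α` by independence
(`exists_dominating`). By Fubini the bound holds for almost every frozen `r`. It passes to `f.solve`
on the axes because scaled innovations charge every neighbourhood of an axis point
(`AxisTails.solve_single_le`).

Finally the noise is integrated out. The frozen integrals are bounded by a constant times `D r ^ α`,
so dominated convergence applies (`AxisTails.tendsto_integral_solve`). The same estimate makes the
limit law boundedly finite. -/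

namespace ExtremalSCM

/-! ### Continuous convergence -/

section Topology

/-- Sequential continuous convergence along functions of the real parameter is convergence along
the product filter. -/
theorem tendsto_prod_of_forall_tendsto {A B : Type*} [TopologicalSpace A]
    [FirstCountableTopology A] [TopologicalSpace B] {Φ : ℝ≥0 → A → B} {y : A} {b : B}
    (h : ∀ x : ℝ≥0 → A, Tendsto x atTop (𝓝 y) → Tendsto (fun t => Φ t (x t)) atTop (𝓝 b)) :
    Tendsto (fun p : ℝ≥0 × A => Φ p.1 p.2) (atTop ×ˢ 𝓝 y) (𝓝 b) := by
  refine tendsto_iff_forall_eventually_mem.2 fun U hU => ?_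
  by_contra hcon
  obtain ⟨w, hw, hwU⟩ := exists_seq_forall_of_frequently (not_eventually.1 hcon)
  have hw1 : Tendsto (fun n => (w n).1) atTop atTop := tendsto_fst.comp hw
  have hw2 : Tendsto (fun n => (w n).2) atTop (𝓝 y) := tendsto_snd.comp hw
  -- Strictly increasing times make `τ` injective, so the bad points all fit on one function `x` of
  -- the parameter, equal to `y` at all other times. Since `x` tends to `y`, the hypothesis
  -- contradicts their badness.
  obtain ⟨φ, hφ, hφw⟩ := strictMono_subseq_of_tendsto_atTop hw1
  set τ : ℕ → ℝ≥0 := (fun n => (w n).1) ∘ φ with hτ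
  have hinj : Function.Injective τ := hφw.injective
  have hτt : Tendsto τ atTop atTop := hw1.comp hφ.tendsto_atTop
  let x : ℝ≥0 → A := Function.extend τ (fun n => (w (φ n)).2) (fun _ => y)
  have hxτ : ∀ n, x (τ n) = (w (φ n)).2 := fun n => hinj.extend_apply _ _ n
  have hx : Tendsto x atTop (𝓝 y) := by
    refine tendsto_iff_forall_eventually_mem.2 fun O hO => ?_
    obtain ⟨n₀, hn₀⟩ := eventually_atTop.1 ((hw2.comp hφ.tendsto_atTop).eventually_mem hO)
    filter_upwards [eventually_ge_atTop (τ n₀)] with t ht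
    by_cases hex : ∃ n, τ n = t
    · obtain ⟨n, rfl⟩ := hex
      rw [hxτ]
      exact hn₀ n (hφw.le_iff_le.1 ht)
    · simp only [x, Function.extend_apply' _ _ _ hex]
      exact mem_of_mem_nhds hO
  obtain ⟨n, hn⟩ := ((h x hx).comp hτt |>.eventually_mem hU).exists
  refine hwU (φ n) ?_
  simp only [Function.comp_apply, hxτ n] at hn
  exact hn

/-- A continuous limit of arbitrary functions is continuous. -/
theorem continuous_of_tendsto_prod {ι A B : Type*} [TopologicalSpace A] [TopologicalSpace B]
    [RegularSpace B] {l : Filter ι} [l.NeBot] {h : ι → A → B} {h₀ : A → B}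
    (H : ∀ x, Tendsto (fun p : ι × A => h p.1 p.2) (l ×ˢ 𝓝 x) (𝓝 (h₀ x))) : Continuous h₀ := by
  refine continuous_iff_continuousAt.2 fun x => ?_
  -- Closed neighbourhoods survive the limit in `i`; regularity of `B` supplies a basis of them.
  refine (closed_nhds_basis (h₀ x)).tendsto_right_iff.2 fun C hC => ?_
  obtain ⟨pa, hpa, pb, hpb, hp⟩ := eventually_prod_iff.1 ((H x).eventually_mem hC.1)
  filter_upwards [eventually_eventually_nhds.2 hpb] with y hy
  have hlim : Tendsto (fun i => h i y) l (𝓝 (h₀ y)) :=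
    (H y).comp (tendsto_id.prodMk (tendsto_const_nhds (x := y) |>.mono_right le_rfl))
  exact hC.2.mem_of_tendsto hlim (hpa.mono fun i hi => hp hi hy.self_of_nhds)

end Topology

/-! ### The improper Pareto measure -/

section Pareto

variable {α s : ℝ}

theorem improperPareto_Ioi (hα : 0 < α) (hs : 0 < s) {y : ℝ≥0} (hy : 0 < y) :
    improperPareto α s (Set.Ioi y) = ENNReal.ofReal (s * (y : ℝ) ^ (-α)) := by
  -- For a single node, `Λ^⊥` is the improper Pareto measure on the only half-axis.
  have h := lambdaPerp_tail (V := Unit) hα hs () hy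
  have hemb : MeasurableEmbedding (Subtype.val : Punctured Unit → Unit → ℝ≥0) :=
    MeasurableEmbedding.subtype_coe (measurableSet_singleton (0 : Unit → ℝ≥0)).compl
  have himg : Subtype.val '' {p : Punctured Unit | y < p.1 ()} = {p : Unit → ℝ≥0 | y < p ()} := by
    ext p
    constructor
    · rintro ⟨q, hq, rfl⟩
      exact hq
    · intro hp
      refine ⟨⟨p, ?_⟩, hp, rfl⟩
      rintro rfl
      exact absurd hp (by simp)
  have hmeas : MeasurableSet {p : Unit → ℝ≥0 | y < p ()} :=
    measurableSet_lt measurable_const (measurable_pi_apply _)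
  rw [lambdaPerp, puncture, hemb.comap_apply, himg, Measure.sum_apply _ hmeas, tsum_fintype,
    Finset.univ_unique, Finset.sum_singleton, Measure.map_apply (continuous_single _).measurable
      hmeas] at h
  rw [← h]
  congr 1

theorem improperPareto_singleton_zero : improperPareto α s {0} = 0 := by
  rw [improperPareto, Measure.map_apply measurable_real_toNNReal (measurableSet_singleton _),
    withDensity_apply _ (measurable_real_toNNReal (measurableSet_singleton _)),
    Measure.restrict_restrict (measurable_real_toNNReal (measurableSet_singleton _))]
  have : Real.toNNReal ⁻¹' {0} ∩ Set.Ioi 0 = ∅ := by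
    ext r
    simp
  simp [this]

instance : SFinite (improperPareto α s) := by
  unfold improperPareto
  infer_instance

end Pareto

/-! ### Regularly varying innovations with extremal independence -/

section Tails

variable {V : Type*} {Ω : Type*} [MeasurableSpace Ω]

/-- The components of `ζ` have tails `s t^(-α)`, and are pairwise extremally independent. -/
structure AxisTails (α s : ℝ) (P : Measure Ω) (ζ : Ω → V → ℝ≥0) : Prop where
  measurable : Measurable ζ
  tail : ∀ v, Tendsto (fun t : ℝ≥0 => (t : ℝ) ^ α * P.real {ω | t < ζ ω v}) atTop (𝓝 s)
  pair : ∀ u v, u ≠ v →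
    Tendsto (fun t : ℝ≥0 => (t : ℝ) ^ α * P.real {ω | t < ζ ω u ∧ t < ζ ω v}) atTop (𝓝 0)

variable {α s : ℝ} {P : Measure Ω} {ζ : Ω → V → ℝ≥0}

theorem AxisTails.measurable_apply (h : AxisTails α s P ζ) (v : V) :
    Measurable fun ω => ζ ω v := (measurable_pi_apply v).comp h.measurable

theorem AxisTails.measurableSet_exceedance (h : AxisTails α s P ζ) (v : V) (t : ℝ≥0) :
    MeasurableSet {ω | t < ζ ω v} :=
  measurableSet_lt measurable_const (h.measurable_apply v)

theorem tendsto_mul_atTop {c : ℝ≥0} (hc : 0 < c) : Tendsto (fun t : ℝ≥0 => c * t) atTop atTop :=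
  by
  simpa only [mul_comm c, id] using (tendsto_id (α := ℝ≥0) (x := atTop)).atTop_mul_const hc

theorem rpow_mul_scale {c : ℝ≥0} (hc : 0 < c) (α : ℝ) (t : ℝ≥0) :
    (t : ℝ) ^ α = (c : ℝ) ^ (-α) * ((c * t : ℝ≥0) : ℝ) ^ α := by
  have hc' : (0 : ℝ) < c := hc
  rw [NNReal.coe_mul, Real.mul_rpow c.coe_nonneg t.coe_nonneg, ← mul_assoc, ← Real.rpow_add hc']
  simp

theorem AxisTails.tail_scaled (h : AxisTails α s P ζ) (v : V) {c : ℝ≥0} (hc : 0 < c) :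
    Tendsto (fun t : ℝ≥0 => (t : ℝ) ^ α * P.real {ω | c * t < ζ ω v}) atTop
      (𝓝 (s * (c : ℝ) ^ (-α))) := by
  have := (((h.tail v).comp (tendsto_mul_atTop hc)).const_mul ((c : ℝ) ^ (-α)))
  rw [mul_comm s]
  refine this.congr fun t => ?_
  simp only [Function.comp_apply]
  rw [rpow_mul_scale hc α t, mul_assoc]

theorem AxisTails.pair_scaled [IsProbabilityMeasure P] (h : AxisTails α s P ζ) {u v : V}
    (huv : u ≠ v) {a b : ℝ≥0}
    (ha : 0 < a) (hb : 0 < b) :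
    Tendsto (fun t : ℝ≥0 => (t : ℝ) ^ α * P.real {ω | a * t < ζ ω u ∧ b * t < ζ ω v}) atTop
      (𝓝 0) := by
  set c := min a b with hc
  have hc0 : 0 < c := lt_min ha hb
  have := (((h.pair u v huv).comp (tendsto_mul_atTop hc0)).const_mul ((c : ℝ) ^ (-α)))
  rw [mul_zero] at this
  refine squeeze_zero (fun t => by positivity) (fun t => ?_) this
  simp only [Function.comp_apply]
  rw [rpow_mul_scale hc0 α t, mul_assoc]
  refine mul_le_mul_of_nonneg_left (mul_le_mul_of_nonneg_left
    (measureReal_mono (fun ω hω => ?_) (measure_ne_top _ _)) (by positivity)) (by positivity)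
  exact ⟨(mul_le_mul_left (min_le_left a b) t).trans_lt hω.1,
    (mul_le_mul_left (min_le_right a b) t).trans_lt hω.2⟩

theorem AxisTails.measureReal_pos [IsProbabilityMeasure P] (h : AxisTails α s P ζ) (hs : 0 < s)
    (v : V) (t : ℝ≥0) :
    0 < P.real {ω | t < ζ ω v} := by
  obtain ⟨t', ht', htt'⟩ := (((h.tail v).eventually_const_lt hs).and (eventually_ge_atTop t)).exists
  have h1 : 0 < P.real {ω | t' < ζ ω v} := by
    by_contra hcon
    have : P.real {ω | t' < ζ ω v} = 0 := le_antisymm (not_lt.1 hcon) measureReal_nonneg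
    simp [this] at ht'
  exact h1.trans_le (measureReal_mono (fun ω hω => htt'.trans_lt hω) (measure_ne_top _ _))

/-- Beyond some `t₀` the convergent tails stay below `s + 1`; before it, probabilities are at most
one. The uniformity in `t` later provides the dominating function. -/
theorem AxisTails.exists_bound [Finite V] [IsProbabilityMeasure P] (h : AxisTails α s P ζ)
    (hα : 0 < α) :
    ∃ K : ℝ, 0 ≤ K ∧ ∀ v, ∀ t : ℝ≥0, (t : ℝ) ^ α * P.real {ω | t < ζ ω v} ≤ K := by
  have hev : ∀ᶠ t : ℝ≥0 in atTop, ∀ v, (t : ℝ) ^ α * P.real {ω | t < ζ ω v} < s + 1 :=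
    eventually_all.2 fun v => (h.tail v).eventually_lt_const (lt_add_one s)
  obtain ⟨t₀, ht₀⟩ := eventually_atTop.1 hev
  refine ⟨max (s + 1) ((t₀ : ℝ) ^ α), le_max_of_le_right (by positivity), fun v t => ?_⟩
  rcases le_total t₀ t with ht | ht
  · exact (ht₀ t ht v).le.trans (le_max_left _ _)
  · refine le_max_of_le_right ?_
    calc (t : ℝ) ^ α * P.real {ω | t < ζ ω v} ≤ (t₀ : ℝ) ^ α * 1 := by
          gcongr
          exact measureReal_le_one
      _ = _ := mul_one _

end Tails

/-! ### Vague convergence on one axis -/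

section OneDim

/-- Convergence of the survival functions at every point implies weak convergence. -/
theorem tendsto_probabilityMeasure_of_Ioi {ι : Type*} {l : Filter ι} [l.IsCountablyGenerated]
    {ν : ι → ProbabilityMeasure ℝ} {ν₀ : ProbabilityMeasure ℝ}
    (h : ∀ a : ℝ, Tendsto (fun i => (ν i : Measure ℝ).real (Set.Ioi a)) l
      (𝓝 ((ν₀ : Measure ℝ).real (Set.Ioi a)))) : Tendsto ν l (𝓝 ν₀) := by
  refine (isPiSystem_Ioc (id : ℝ → ℝ) id).tendsto_probabilityMeasure_of_tendsto_of_mem ?_ ?_ ?_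
  · rintro _ ⟨a, b, _, rfl⟩
    exact measurableSet_Ioc
  · intro u hu x hx
    obtain ⟨ε, hε, hsub⟩ := Metric.isOpen_iff.1 hu x hx
    refine ⟨_, ⟨x - ε / 2, x + ε / 2, by simp only [id]; linarith, rfl⟩,
      Ioc_mem_nhds (by simp only [id]; linarith) (by simp only [id]; linarith), fun y hy => hsub ?_⟩
    simp only [id, Set.mem_Ioc] at hy
    rw [Metric.mem_ball, Real.dist_eq, abs_lt]
    constructor <;> linarith [hy.1, hy.2]
  · rintro _ ⟨a, b, hab, rfl⟩
    have key : ∀ m : ProbabilityMeasure ℝ, ((m (Set.Ioc a b) : ℝ≥0) : ℝ) =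
        (m : Measure ℝ).real (Set.Ioi a) - (m : Measure ℝ).real (Set.Ioi b) := fun m => by
      have hd : Set.Ioc a b = Set.Ioi a \ Set.Ioi b := by
        ext y
        simp
      rw [← measureReal_sdiff (Set.Ioi_subset_Ioi (show a ≤ b from le_of_lt hab)) measurableSet_Ioi,
        ← hd]
      rfl
    rw [← NNReal.tendsto_coe]
    simp only [id, key]
    exact (h a).sub (h b)

theorem measureReal_cond {Ω : Type*} [MeasurableSpace Ω] {μ : Measure Ω} {A : Set Ω}
    (hA : MeasurableSet A) (B : Set Ω) : (μ[|A]).real B = (μ.real A)⁻¹ * μ.real (A ∩ B) := by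
  rw [Measure.real, cond_apply hA, ENNReal.toReal_mul, ENNReal.toReal_inv, Measure.real,
    Measure.real]

theorem integral_eq_measureReal_mul_integral_cond {Ω : Type*} [MeasurableSpace Ω] {μ : Measure Ω}
    {A : Set Ω} (h0 : μ A ≠ 0) (htop : μ A ≠ ∞) {f : Ω → ℝ}
    (hf : ∀ ω, ω ∉ A → f ω = 0) : ∫ ω, f ω ∂μ = μ.real A * ∫ ω, f ω ∂μ[|A] := by
  rw [ProbabilityTheory.cond, integral_smul_measure,
    setIntegral_eq_integral_of_forall_compl_eq_zero hf, smul_eq_mul, ← mul_assoc, ENNReal.toReal_inv, Measure.real, mul_inv_cancel₀, one_mul]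
  exact ENNReal.toReal_ne_zero.2 ⟨h0, htop⟩

variable {V : Type*} {Ω : Type*} [MeasurableSpace Ω] {α s : ℝ} {P : Measure Ω}
  {ζ : Ω → V → ℝ≥0}

/-- As `φ` vanishes up to `δ`, nothing is lost by conditioning on exceedance of `δ`. This replaces
an infinite limit measure by probability laws, whose weak convergence follows from ratios of tails.
-/
theorem AxisTails.tendsto_integral_axis [IsProbabilityMeasure P] (h : AxisTails α s P ζ)
    (hα : 0 < α) (hs : 0 < s) (v : V) {φ : ℝ≥0 → ℝ} (hφ : Continuous φ) {M : ℝ}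
    (hM : ∀ r, |φ r| ≤ M) {δ : ℝ≥0} (hδ : 0 < δ) (hφ0 : ∀ r ≤ δ, φ r = 0) :
    Tendsto (fun t : ℝ≥0 => (t : ℝ) ^ α * ∫ ω, φ (t⁻¹ * ζ ω v) ∂P) atTop
      (𝓝 (∫ r, φ r ∂improperPareto α s)) := by
  have hδ' : (0 : ℝ) < δ := hδ
  have hκr : ∀ c : ℝ≥0, 0 < c → (improperPareto α s).real (Set.Ioi c) = s * (c : ℝ) ^ (-α) :=
    fun c hc => by
      have hc' : (0 : ℝ) < c := hc
      rw [Measure.real, improperPareto_Ioi hα hs hc, ENNReal.toReal_ofReal (by positivity)]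
  have hκtop : ∀ c : ℝ≥0, 0 < c → improperPareto α s (Set.Ioi c) ≠ ∞ := fun c hc => by
    rw [improperPareto_Ioi hα hs hc]
    exact ENNReal.ofReal_ne_top
  have hκ0 : improperPareto α s (Set.Ioi δ) ≠ 0 := by
    rw [improperPareto_Ioi hα hs hδ]
    simp only [ne_eq, ENNReal.ofReal_eq_zero, not_le]
    positivity
  let A : ℝ≥0 → Set Ω := fun t => {ω | δ * t < ζ ω v}
  have hA0 : ∀ t, P (A t) ≠ 0 := fun t h0 => by
    have := h.measureReal_pos hs v (δ * t)
    simp only [A] at h0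
    simp [Measure.real, h0] at this
  have hmf : ∀ t : ℝ≥0, Measurable fun ω => ((t⁻¹ * ζ ω v : ℝ≥0) : ℝ) := fun t =>
    ((h.measurable_apply v).const_mul _).coe_nnreal_real
  have hpt : ∀ t, IsProbabilityMeasure (P[|A t]) := fun t => cond_isProbabilityMeasure (hA0 t)
  have hpκ : IsProbabilityMeasure ((improperPareto α s)[|Set.Ioi δ]) :=
    cond_isProbabilityMeasure_of_finite hκ0 (hκtop δ hδ)
  let ν : ℝ≥0 → ProbabilityMeasure ℝ := fun t =>
    ⟨(P[|A t]).map fun ω => ((t⁻¹ * ζ ω v : ℝ≥0) : ℝ),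
      Measure.isProbabilityMeasure_map (hmf t).aemeasurable⟩
  let ν₀ : ProbabilityMeasure ℝ := ⟨((improperPareto α s)[|Set.Ioi δ]).map ((↑) : ℝ≥0 → ℝ),
    Measure.isProbabilityMeasure_map measurable_coe_nnreal_real.aemeasurable⟩
  have hν : Tendsto ν atTop (𝓝 ν₀) := by
    refine tendsto_probabilityMeasure_of_Ioi fun a => ?_
    -- Given exceedance of `δ`, exceeding `a` means exceeding the maximum of the two; negative `a`
    -- is included through `toNNReal`.
    set c := max δ a.toNNReal with hc
    have hc0 : 0 < c := lt_max_of_lt_left hδ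
    have hcδ : ∀ r : ℝ≥0, (δ < r ∧ a < r) ↔ c < r := fun r => by
      rw [hc, max_lt_iff]
      refine and_congr_right fun hr => ?_
      have := Real.toNNReal_lt_toNNReal_iff (r := a) (p := (r : ℝ)) (hδ.trans hr)
      rw [Real.toNNReal_coe] at this
      exact this.symm
    have e₀ : ((ν₀ : Measure ℝ)).real (Set.Ioi a) =
        (s * (δ : ℝ) ^ (-α))⁻¹ * (s * (c : ℝ) ^ (-α)) := by
      simp only [ν₀, ProbabilityMeasure.coe_mk]
      rw [map_measureReal_apply measurable_coe_nnreal_real measurableSet_Ioi,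
        measureReal_cond measurableSet_Ioi, hκr δ hδ, ← hκr c hc0]
      congr 2
      ext r
      exact hcδ r
    have e : ∀ t : ℝ≥0, 0 < t → ((ν t : Measure ℝ)).real (Set.Ioi a) =
        ((t : ℝ) ^ α * P.real {ω | δ * t < ζ ω v})⁻¹ *
          ((t : ℝ) ^ α * P.real {ω | c * t < ζ ω v}) := fun t ht => by
      have ht' : (0 : ℝ) < (t : ℝ) ^ α := Real.rpow_pos_of_pos ht α
      simp only [ν, ProbabilityMeasure.coe_mk]
      rw [map_measureReal_apply (hmf t) measurableSet_Ioi,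
        measureReal_cond (h.measurableSet_exceedance v _), mul_inv, mul_mul_mul_comm, inv_mul_cancel₀ ht'.ne', one_mul]
      congr 2
      ext ω
      have hdiv : ∀ b : ℝ≥0, b * t < ζ ω v ↔ b < t⁻¹ * ζ ω v := fun b => by
        rw [mul_comm t⁻¹, ← div_eq_mul_inv, lt_div_iff₀ ht]
      change (δ * t < ζ ω v ∧ a < ((t⁻¹ * ζ ω v : ℝ≥0) : ℝ)) ↔ c * t < ζ ω v
      rw [hdiv, hdiv]
      exact hcδ _
    rw [e₀]
    refine Tendsto.congr' ?_ (((h.tail_scaled v hδ).inv₀ (by positivity)).mul (h.tail_scaled v hc0))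
    filter_upwards [eventually_gt_atTop 0] with t ht using (e t ht).symm
  have hint := (ProbabilityMeasure.tendsto_iff_forall_integral_tendsto.1 hν)
    (BoundedContinuousFunction.ofNormedAddCommGroup (fun x : ℝ => φ x.toNNReal)
      (hφ.comp continuous_real_toNNReal) M fun x => hM _)
  simp only [BoundedContinuousFunction.coe_ofNormedAddCommGroup, ν, ν₀,
    ProbabilityMeasure.coe_mk] at hint
  have hφm : StronglyMeasurable fun x : ℝ => φ x.toNNReal :=
    (hφ.comp continuous_real_toNNReal).stronglyMeasurable
  rw [integral_map measurable_coe_nnreal_real.aemeasurable hφm.aestronglyMeasurable] at hint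
  simp only [Real.toNNReal_coe] at hint
  have hlim := (h.tail_scaled v hδ).mul hint
  rw [← hκr δ hδ, ← integral_eq_measureReal_mul_integral_cond hκ0 (hκtop δ hδ)
    (fun r hr => hφ0 r (not_lt.1 hr))] at hlim
  refine hlim.congr' ?_
  filter_upwards [eventually_gt_atTop 0] with t ht
  rw [integral_map (hmf t).aemeasurable hφm.aestronglyMeasurable, mul_assoc]
  simp only [Real.toNNReal_coe]
  rw [← integral_eq_measureReal_mul_integral_cond (hA0 t) (measure_ne_top _ _)]
  intro ω hω
  refine hφ0 _ ?_
  rw [mul_comm t⁻¹, ← div_eq_mul_inv, div_le_iff₀ ht]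
  exact not_lt.1 hω

end OneDim

/-! ### Vague convergence of the innovation vector with varying integrands -/

section Core

variable {V : Type*} [Fintype V] [DecidableEq V]

theorem continuous_axis {V : Type*} [DecidableEq V] (v : V) :
    Continuous fun r : ℝ≥0 => (Pi.single v r : V → ℝ≥0) :=
  continuous_single (A := fun _ : V => ℝ≥0) v

/-- Continuous convergence is uniform near compact parts of the coordinate axes. -/
theorem exists_uniform_near_axis {h : ℝ≥0 → (V → ℝ≥0) → ℝ} {h₀ : (V → ℝ≥0) → ℝ}
    (hlim : ∀ z, Tendsto (fun p : ℝ≥0 × (V → ℝ≥0) => h p.1 p.2) (atTop ×ˢ 𝓝 z) (𝓝 (h₀ z)))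
    (v : V) (R : ℝ≥0) {e : ℝ} (he : 0 < e) :
    ∃ ε : ℝ≥0, 0 < ε ∧ ∀ᶠ t in atTop, ∀ z : V → ℝ≥0, z v ≤ R → (∀ u, u ≠ v → z u ≤ ε) →
      |h t z - h₀ (Pi.single v (z v))| ≤ e := by
  have hcont : Continuous h₀ := continuous_of_tendsto_prod hlim
  have hcs : Continuous fun z : V → ℝ≥0 => h₀ (Pi.single v (z v)) :=
    hcont.comp ((continuous_axis v).comp (continuous_apply v))
  let K : Set (V → ℝ≥0) := (fun r : ℝ≥0 => Pi.single v r) '' Set.Icc 0 R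
  have hK : IsCompact K := isCompact_Icc.image (continuous_axis v)
  -- Compactness of the axis segment `K` turns convergence at each of its points into a bound on a
  -- whole neighbourhood of `K`, uniformly for large `t`.
  have hmem : {p : ℝ≥0 × (V → ℝ≥0) | |h p.1 p.2 - h₀ (Pi.single v (p.2 v))| ≤ e} ∈
      atTop ×ˢ 𝓝ˢ K := by
    refine hK.mem_prod_nhdsSet_of_forall ?_
    rintro _ ⟨r, _, rfl⟩
    have h1 : Tendsto (fun p : ℝ≥0 × (V → ℝ≥0) => h p.1 p.2 - h₀ (Pi.single v (p.2 v)))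
        (atTop ×ˢ 𝓝 (Pi.single v r)) (𝓝 0) := by
      have h2 := (hlim (Pi.single v r)).sub ((hcs.tendsto (Pi.single v r)).comp
        (tendsto_snd (f := (atTop : Filter ℝ≥0))))
      simpa using h2
    filter_upwards [h1.eventually_mem (Metric.closedBall_mem_nhds 0 he)] with p hp
    simpa [Real.dist_eq] using hp
  obtain ⟨S, hS, T, hT, hST⟩ := mem_prod_iff.1 hmem
  obtain ⟨O, hO, hKO, hOT⟩ := mem_nhdsSet_iff_exists.1 hT
  obtain ⟨ρ, hρ, hthick⟩ := hK.exists_thickening_subset_open hO hKO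
  refine ⟨⟨ρ / 2, by positivity⟩, by exact_mod_cast half_pos hρ, ?_⟩
  filter_upwards [hS] with t ht z hzR hz
  refine hST (Set.mk_mem_prod ht (hOT (hthick ?_)) : (t, z) ∈ S ×ˢ T)
  rw [Metric.mem_thickening_iff]
  refine ⟨_, ⟨z v, ⟨zero_le, hzR⟩, rfl⟩, lt_of_le_of_lt ?_ (half_lt_self hρ)⟩
  refine (dist_pi_le_iff (half_pos hρ).le).2 fun u => ?_
  by_cases huv : u = v
  · subst huv
    simp [(half_pos hρ).le]
  · have h3 : (z u : ℝ) ≤ ρ / 2 := by exact_mod_cast hz u huv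
    simpa [huv, NNReal.dist_eq] using h3

/-- Comparison of a function near the axes with its values on the axes. -/
theorem abs_sub_sum_axis_le {h h₀ : (V → ℝ≥0) → ℝ} {M : ℝ} (hM : ∀ z, |h z| ≤ M)
    (hM₀ : ∀ z, |h₀ z| ≤ M) {δ R ε : ℝ≥0} (hεδ : ε ≤ δ) {e : ℝ} (he : 0 ≤ e)
    (hzero₀ : ∀ v, ∀ r ≤ δ, h₀ (Pi.single v r) = 0) {z : V → ℝ≥0}
    (hz : (∀ v, z v ≤ δ) → h z = 0)
    (hnear : ∀ v, z v ≤ R → (∀ u, u ≠ v → z u ≤ ε) → |h z - h₀ (Pi.single v (z v))| ≤ e) :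
    |h z - ∑ v, h₀ (Pi.single v (z v))| ≤
      ∑ v, {z : V → ℝ≥0 | δ < z v}.indicator (fun _ => e) z +
      (∑ v, {z : V → ℝ≥0 | R < z v}.indicator (fun _ => (1 + Fintype.card V) * M) z +
      ∑ p ∈ Finset.univ.offDiag, {z : V → ℝ≥0 | ε < z p.1 ∧ ε < z p.2}.indicator
        (fun _ => (1 + Fintype.card V) * M) z) := by
  have hM0 : 0 ≤ M := (abs_nonneg _).trans (hM z)
  have hM1 : 0 ≤ (1 + Fintype.card V) * M := by positivity
  have n1 : ∀ v, 0 ≤ {z : V → ℝ≥0 | δ < z v}.indicator (fun _ => e) z := fun v =>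
    Set.indicator_nonneg (fun _ _ => he) _
  have n2 : ∀ v, 0 ≤ {z : V → ℝ≥0 | R < z v}.indicator (fun _ => (1 + Fintype.card V) * M) z :=
    fun v => Set.indicator_nonneg (fun _ _ => hM1) _
  have n3 : ∀ p : V × V, 0 ≤ {z : V → ℝ≥0 | ε < z p.1 ∧ ε < z p.2}.indicator
      (fun _ => (1 + Fintype.card V) * M) z := fun p => Set.indicator_nonneg (fun _ _ => hM1) _
  have s1 := Finset.sum_nonneg fun v (_ : v ∈ Finset.univ) => n1 v
  have s2 := Finset.sum_nonneg fun v (_ : v ∈ Finset.univ) => n2 v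
  have s3 := Finset.sum_nonneg fun p (_ : p ∈ (Finset.univ : Finset V).offDiag) => n3 p
  have hcrude : |h z - ∑ v, h₀ (Pi.single v (z v))| ≤ (1 + Fintype.card V) * M := by
    calc |h z - ∑ v, h₀ (Pi.single v (z v))| ≤ |h z| + |∑ v, h₀ (Pi.single v (z v))| := abs_sub _ _
      _ ≤ M + ∑ _v : V, M := add_le_add (hM z)
          ((Finset.abs_sum_le_sum_abs _ _).trans (Finset.sum_le_sum fun v _ => hM₀ _))
      _ = _ := by simp; ring
  -- Two coordinates above `ε`, or one above `R`, cost the crude bound. Otherwise a coordinate above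
  -- `δ ≥ ε` forces the others below `ε`, and the near-axis estimate applies. If none exceeds `δ`,
  -- both terms vanish.
  by_cases hpair : ∃ u v, u ≠ v ∧ ε < z u ∧ ε < z v
  · obtain ⟨u, v, huv, hu, hv⟩ := hpair
    have := Finset.single_le_sum (fun p _ => n3 p)
      (show (u, v) ∈ (Finset.univ : Finset V).offDiag by simp [huv])
    rw [Set.indicator_of_mem (show z ∈ {z : V → ℝ≥0 | ε < z u ∧ ε < z v} from ⟨hu, hv⟩)] at this
    linarith
  by_cases hlarge : ∃ v, R < z v
  · obtain ⟨v, hv⟩ := hlarge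
    have := Finset.single_le_sum (fun v _ => n2 v) (Finset.mem_univ v)
    rw [Set.indicator_of_mem (show z ∈ {z : V → ℝ≥0 | R < z v} from hv)] at this
    linarith
  push Not at hpair hlarge
  by_cases hmid : ∃ v, δ < z v
  · obtain ⟨v, hv⟩ := hmid
    have hothers : ∀ u, u ≠ v → z u ≤ ε := fun u hu =>
      hpair v u hu.symm (hεδ.trans_lt hv)
    have hsum : ∑ u, h₀ (Pi.single u (z u)) = h₀ (Pi.single v (z v)) :=
      Finset.sum_eq_single v (fun u _ hu => hzero₀ u _ ((hothers u hu).trans hεδ)) (by simp)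
    have := Finset.single_le_sum (fun v _ => n1 v) (Finset.mem_univ v)
    rw [Set.indicator_of_mem (show z ∈ {z : V → ℝ≥0 | δ < z v} from hv)] at this
    rw [hsum]
    linarith [hnear v (hlarge v) hothers]
  · push Not at hmid
    rw [hz hmid, Finset.sum_eq_zero fun v _ => hzero₀ v _ (hmid v)]
    simpa using by linarith

theorem lt_inv_mul_iff_mul_lt {t : ℝ≥0} (ht : 0 < t) (b r : ℝ≥0) : b < t⁻¹ * r ↔ b * t < r := by
  rw [mul_comm t⁻¹, ← div_eq_mul_inv, lt_div_iff₀ ht]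

variable {Ω : Type*} [MeasurableSpace Ω] {α s : ℝ} {P : Measure Ω} [IsProbabilityMeasure P]
  {ζ : Ω → V → ℝ≥0}

/-- Single big jump: up to a negligible error, `h t` at the scaled innovations is the sum of the
values of `h₀` at their projections to the axes, and each summand is a one-dimensional problem. -/
theorem AxisTails.tendsto_integral (hζ : AxisTails α s P ζ) (hα : 0 < α) (hs : 0 < s)
    {h : ℝ≥0 → (V → ℝ≥0) → ℝ} {h₀ : (V → ℝ≥0) → ℝ} {M : ℝ} (hmeas : ∀ t, Measurable (h t))
    (hM : ∀ t z, |h t z| ≤ M) (hM₀ : ∀ z, |h₀ z| ≤ M)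
    (hlim : ∀ z, Tendsto (fun p : ℝ≥0 × (V → ℝ≥0) => h p.1 p.2) (atTop ×ˢ 𝓝 z) (𝓝 (h₀ z)))
    {δ : ℝ≥0} (hδ : 0 < δ)
    (hzero : ∀ᶠ t in atTop, ∀ᵐ ω ∂P, (∀ v, ζ ω v ≤ δ * t) → h t (t⁻¹ • ζ ω) = 0)
    (hzero₀ : ∀ v, ∀ r ≤ δ, h₀ (Pi.single v r) = 0) :
    Tendsto (fun t : ℝ≥0 => (t : ℝ) ^ α * ∫ ω, h t (t⁻¹ • ζ ω) ∂P) atTop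
      (𝓝 (∑ v, ∫ r, h₀ (Pi.single v r) ∂improperPareto α s)) := by
  have hcont : Continuous h₀ := continuous_of_tendsto_prod hlim
  have hM0 : 0 ≤ M := (abs_nonneg _).trans (hM₀ 0)
  have haxis : ∀ v, Tendsto (fun t : ℝ≥0 =>
      (t : ℝ) ^ α * ∫ ω, h₀ (Pi.single v (t⁻¹ * ζ ω v)) ∂P) atTop
      (𝓝 (∫ r, h₀ (Pi.single v r) ∂improperPareto α s)) := fun v =>
    hζ.tendsto_integral_axis hα hs v (hcont.comp (continuous_axis v)) (fun r => hM₀ _) hδ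
      (hzero₀ v)
  have hsc : ∀ t : ℝ≥0, Measurable fun ω => t⁻¹ • ζ ω := fun t =>
    measurable_pi_lambda _ fun v => (hζ.measurable_apply v).const_mul _
  have hint : ∀ t : ℝ≥0, Integrable (fun ω => h t (t⁻¹ • ζ ω)) P := fun t =>
    Integrable.of_bound ((hmeas t).comp (hsc t)).aestronglyMeasurable M
      (Eventually.of_forall fun ω => hM _ _)
  have hint₀ : ∀ (t : ℝ≥0) v, Integrable (fun ω => h₀ (Pi.single v (t⁻¹ * ζ ω v))) P := fun t v =>
    Integrable.of_bound ((hcont.comp (continuous_axis v)).measurable.comp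
      ((hζ.measurable_apply v).const_mul _)).aestronglyMeasurable M
      (Eventually.of_forall fun ω => hM₀ _)
  have hdiff : Tendsto (fun t : ℝ≥0 => (t : ℝ) ^ α * ∫ ω, h t (t⁻¹ • ζ ω) ∂P -
      ∑ v, (t : ℝ) ^ α * ∫ ω, h₀ (Pi.single v (t⁻¹ * ζ ω v)) ∂P) atTop (𝓝 0) := by
    refine Metric.tendsto_nhds.2 fun η hη => ?_
    set n : ℝ := ((Fintype.card V : ℕ) : ℝ) with hn
    have hδ' : (0 : ℝ) < δ := hδ
    -- The order of choices matters: `R` makes the far part cost less than `η / 2`, then `e` does so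
    -- for the near-axis error, and only then is `ε₀` chosen, depending on both. The pair terms
    -- vanish in the limit for any `ε₀`.
    obtain ⟨R, hR, hR0⟩ : ∃ R : ℝ≥0, n * (s * (R : ℝ) ^ (-α) * ((1 + n) * M)) < η / 2 ∧ 0 < R := by
      have h1 : Tendsto (fun R : ℝ≥0 => n * (s * (R : ℝ) ^ (-α) * ((1 + n) * M))) atTop (𝓝 0) := by
        have h2 : Tendsto (fun R : ℝ≥0 => (R : ℝ) ^ (-α)) atTop (𝓝 0) :=
          (tendsto_rpow_neg_atTop hα).comp (NNReal.tendsto_coe_atTop.2 tendsto_id)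
        simpa using ((h2.const_mul s).mul_const ((1 + n) * M)).const_mul n
      exact ((h1.eventually_lt_const (half_pos hη)).and (eventually_gt_atTop 0)).exists
    obtain ⟨e, he, heη⟩ : ∃ e : ℝ, 0 < e ∧ n * (s * (δ : ℝ) ^ (-α) * e) < η / 2 := by
      have hc : 0 ≤ n * (s * (δ : ℝ) ^ (-α)) := by positivity
      refine ⟨η / 2 / (n * (s * (δ : ℝ) ^ (-α)) + 1), by positivity, ?_⟩
      rw [← mul_assoc, mul_div_assoc', div_lt_iff₀ (by positivity)]
      nlinarith
    choose ε hε hnear using fun v => exists_uniform_near_axis hlim v R he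
    obtain ⟨ε₀, hε₀, hε₀δ, hε₀v⟩ : ∃ ε₀ : ℝ≥0, 0 < ε₀ ∧ ε₀ ≤ δ ∧ ∀ v, ε₀ ≤ ε v := by
      have h1 : ∀ c : ℝ≥0, 0 < c → ∀ᶠ x in 𝓝[>] (0 : ℝ≥0), x ≤ c := fun c hc =>
        eventually_nhdsWithin_of_eventually_nhds (Iic_mem_nhds hc)
      obtain ⟨x, h2, h3, h4⟩ := ((eventually_mem_nhdsWithin (a := (0 : ℝ≥0)) (s := Set.Ioi 0)).and
        ((h1 δ hδ).and (eventually_all.2 fun v => h1 (ε v) (hε v)))).exists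
      exact ⟨x, h2, h3, h4⟩
    have hBlim : Tendsto (fun t : ℝ≥0 => ∑ v, (t : ℝ) ^ α * P.real {ω | δ * t < ζ ω v} * e +
        (∑ v, (t : ℝ) ^ α * P.real {ω | R * t < ζ ω v} * ((1 + n) * M) +
        ∑ p ∈ (Finset.univ : Finset V).offDiag,
          (t : ℝ) ^ α * P.real {ω | ε₀ * t < ζ ω p.1 ∧ ε₀ * t < ζ ω p.2} * ((1 + n) * M))) atTop
        (𝓝 (∑ _v : V, s * (δ : ℝ) ^ (-α) * e + (∑ _v : V, s * (R : ℝ) ^ (-α) * ((1 + n) * M) +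
          ∑ p ∈ (Finset.univ : Finset V).offDiag, 0 * ((1 + n) * M)))) :=
      (tendsto_finsetSum _ fun v _ => (hζ.tail_scaled v hδ).mul_const _).add
        ((tendsto_finsetSum _ fun v _ => (hζ.tail_scaled v hR0).mul_const _).add
          (tendsto_finsetSum _ fun p hp =>
            (hζ.pair_scaled (Finset.mem_offDiag.1 hp).2.2 hε₀ hε₀).mul_const _))
    have hBη := hBlim.eventually_lt_const (u := η) (by
      simp only [Finset.sum_const, Finset.card_univ, nsmul_eq_mul, zero_mul, mul_zero, add_zero,
        ← hn]
      linarith)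
    filter_upwards [hBη, hzero, eventually_all.2 hnear, eventually_gt_atTop 0] with t hB hz hnr ht
    rw [dist_zero_right, Real.norm_eq_abs]
    refine lt_of_le_of_lt ?_ hB
    have htα : (0 : ℝ) ≤ (t : ℝ) ^ α := by positivity
    rw [← Finset.mul_sum, ← mul_sub, ← integral_finsetSum _ fun v _ => hint₀ t v,
      ← integral_sub (hint t) (integrable_finsetSum _ fun v _ => hint₀ t v), abs_mul,
      abs_of_nonneg htα]
    have hms : ∀ (b : ℝ≥0) v, MeasurableSet {ω | b < (t⁻¹ • ζ ω) v} := fun b v =>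
      measurableSet_lt measurable_const ((measurable_pi_apply v).comp (hsc t))
    have hindI : ∀ (b : ℝ≥0) v (c : ℝ),
        Integrable (fun ω => {z : V → ℝ≥0 | b < z v}.indicator (fun _ => c) (t⁻¹ • ζ ω)) P :=
      fun b v c => (integrable_const c).indicator (hms b v)
    have hindP : ∀ (p : V × V) (c : ℝ), Integrable (fun ω =>
        {z : V → ℝ≥0 | ε₀ < z p.1 ∧ ε₀ < z p.2}.indicator (fun _ => c) (t⁻¹ • ζ ω)) P :=
      fun p c => (integrable_const c).indicator ((hms _ _).inter (hms _ _))
    have hindv : ∀ (b : ℝ≥0) v (c : ℝ),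
        ∫ ω, {z : V → ℝ≥0 | b < z v}.indicator (fun _ => c) (t⁻¹ • ζ ω) ∂P =
          P.real {ω | b * t < ζ ω v} * c := fun b v c => by
      have hset : {ω | b < (t⁻¹ • ζ ω) v} = {ω | b * t < ζ ω v} :=
        Set.ext fun ω => lt_inv_mul_iff_mul_lt ht b _
      rw [← hset]
      exact (integral_indicator_const c (hms b v)).trans (smul_eq_mul _ _)
    have hindp : ∀ (p : V × V) (c : ℝ),
        ∫ ω, {z : V → ℝ≥0 | ε₀ < z p.1 ∧ ε₀ < z p.2}.indicator (fun _ => c) (t⁻¹ • ζ ω) ∂P =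
          P.real {ω | ε₀ * t < ζ ω p.1 ∧ ε₀ * t < ζ ω p.2} * c := fun p c => by
      have hset : {ω | ε₀ < (t⁻¹ • ζ ω) p.1 ∧ ε₀ < (t⁻¹ • ζ ω) p.2} =
          {ω | ε₀ * t < ζ ω p.1 ∧ ε₀ * t < ζ ω p.2} :=
        Set.ext fun ω => and_congr (lt_inv_mul_iff_mul_lt ht ε₀ _) (lt_inv_mul_iff_mul_lt ht ε₀ _)
      rw [← hset]
      exact (integral_indicator_const c ((hms _ _).inter (hms _ _))).trans (smul_eq_mul _ _)
    have hI1 := integrable_finsetSum Finset.univ fun v _ => hindI δ v e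
    have hI2 := integrable_finsetSum Finset.univ fun v _ => hindI R v ((1 + n) * M)
    have hI3 := integrable_finsetSum (Finset.univ : Finset V).offDiag
      fun p _ => hindP p ((1 + n) * M)
    have hpt : ∀ᵐ ω ∂P, ‖h t (t⁻¹ • ζ ω) - ∑ v, h₀ (Pi.single v (t⁻¹ * ζ ω v))‖ ≤
        ∑ v, {z : V → ℝ≥0 | δ < z v}.indicator (fun _ => e) (t⁻¹ • ζ ω) +
        (∑ v, {z : V → ℝ≥0 | R < z v}.indicator (fun _ => (1 + n) * M) (t⁻¹ • ζ ω) +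
        ∑ p ∈ Finset.univ.offDiag, {z : V → ℝ≥0 | ε₀ < z p.1 ∧ ε₀ < z p.2}.indicator
          (fun _ => (1 + n) * M) (t⁻¹ • ζ ω)) := by
      filter_upwards [hz] with ω hω
      refine abs_sub_sum_axis_le (z := t⁻¹ • ζ ω) (hM t) hM₀ hε₀δ he.le hzero₀
        (fun hle => hω fun v => ?_)
        (fun v hv hu => hnr v _ hv fun u huv => (hu u huv).trans (hε₀v v))
      exact not_lt.1 fun hlt => (hle v).not_gt ((lt_inv_mul_iff_mul_lt ht δ _).2 hlt)
    have hfin := norm_integral_le_of_norm_le (hI1.add (hI2.add hI3)) hpt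
    rw [Real.norm_eq_abs] at hfin
    refine (mul_le_mul_of_nonneg_left hfin htα).trans_eq ?_
    rw [integral_add' hI1 (hI2.add hI3), integral_add' hI2 hI3,
      integral_finsetSum _ fun v _ => hindI δ v e,
      integral_finsetSum _ fun v _ => hindI R v _, integral_finsetSum _ fun p _ => hindP p _]
    simp only [hindv, hindp, mul_add, Finset.mul_sum, mul_assoc]
  have := hdiff.add (tendsto_finsetSum Finset.univ fun v _ => haxis v)
  simpa using this

/-- Scaled innovations visit every neighbourhood of every point of the open axes. -/
theorem AxisTails.eventually_measure_pos (hζ : AxisTails α s P ζ) (hα : 0 < α) (hs : 0 < s) (v : V)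
    {r : ℝ≥0} (hr : 0 < r) {U : Set (V → ℝ≥0)} (hU : U ∈ 𝓝 (Pi.single v r)) :
    ∀ᶠ t : ℝ≥0 in atTop, P {ω | t⁻¹ • ζ ω ∈ U} ≠ 0 := by
  obtain ⟨ρ, hρ, hball⟩ := Metric.mem_nhds_iff.1 hU
  obtain ⟨ε, hε, hερ, hεr⟩ : ∃ ε : ℝ≥0, 0 < ε ∧ (ε : ℝ) < ρ ∧ ε < r := by
    obtain ⟨ε, h0, h1⟩ := exists_between (show (0 : ℝ≥0) < min ⟨ρ, hρ.le⟩ r from lt_min hρ hr)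
    exact ⟨ε, h0, (lt_min_iff.1 h1).1, (lt_min_iff.1 h1).2⟩
  set a := r - ε with ha
  have ha0 : 0 < a := tsub_pos_of_lt hεr
  set b := r + ε with hb
  have hab : a < b := (tsub_le_self).trans_lt (lt_add_of_pos_right r hε)
  -- The event that coordinate `v` lies in `(a, b]` while the others stay below `ε` forces the
  -- scaled vector into `U`. Its normalised probability is bounded below by this difference, whose
  -- limit is positive.
  have hlim := ((hζ.tail_scaled v ha0).sub (hζ.tail_scaled v (ha0.trans hab))).sub
    (tendsto_finsetSum (Finset.univ.erase v) fun u hu =>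
      hζ.pair_scaled (Finset.ne_of_mem_erase hu) hε ha0)
  have hpos : (0 : ℝ) < s * (a : ℝ) ^ (-α) - s * (b : ℝ) ^ (-α) -
      ∑ u ∈ Finset.univ.erase v, (0 : ℝ) := by
    have : (b : ℝ) ^ (-α) < (a : ℝ) ^ (-α) :=
      Real.rpow_lt_rpow_of_neg (by exact_mod_cast ha0) (by exact_mod_cast hab) (by linarith)
    simp only [Finset.sum_const_zero, sub_zero]
    nlinarith
  filter_upwards [hlim.eventually_const_lt hpos, eventually_gt_atTop 0] with t ht ht0 hnull
  have hcover : {ω | a * t < ζ ω v} ⊆ {ω | b * t < ζ ω v} ∪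
      ((⋃ u ∈ Finset.univ.erase v, {ω | ε * t < ζ ω u ∧ a * t < ζ ω v}) ∪
        {ω | t⁻¹ • ζ ω ∈ U}) := by
    intro ω hω
    by_contra hcon
    simp only [Set.mem_union, Set.mem_iUnion, Set.mem_ofPred_eq, not_or, not_exists,
      not_and] at hcon
    obtain ⟨h1, h2, h3⟩ := hcon
    refine h3 (hball ?_)
    rw [Metric.mem_ball]
    refine lt_of_le_of_lt ((dist_pi_le_iff ε.coe_nonneg).2 fun u => ?_) hερ
    by_cases huv : u = v
    · subst huv
      have h4 : a < t⁻¹ * ζ ω u := (lt_inv_mul_iff_mul_lt ht0 _ _).2 hω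
      have h5 : t⁻¹ * ζ ω u ≤ b := not_lt.1 fun hlt => h1 ((lt_inv_mul_iff_mul_lt ht0 _ _).1 hlt)
      have h6 : (a : ℝ) = r - ε := NNReal.coe_sub hεr.le
      have h7 : (b : ℝ) = r + ε := NNReal.coe_add _ _
      have h4' : (a : ℝ) < ((t⁻¹ * ζ ω u : ℝ≥0) : ℝ) := h4
      have h5' : ((t⁻¹ * ζ ω u : ℝ≥0) : ℝ) ≤ b := h5
      simp only [Pi.smul_apply, smul_eq_mul, Pi.single_eq_same, NNReal.dist_eq]
      rw [abs_le]
      constructor <;> linarith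
    · have h4 : t⁻¹ * ζ ω u ≤ ε := not_lt.1 fun hlt =>
        h2 u (by simp [huv]) ((lt_inv_mul_iff_mul_lt ht0 _ _).1 hlt) hω
      have h5 : ((t⁻¹ * ζ ω u : ℝ≥0) : ℝ) ≤ ε := h4
      simpa [huv, NNReal.dist_eq] using h5
  have hreal : P.real {ω | t⁻¹ • ζ ω ∈ U} = 0 := by
    rw [Measure.real, hnull, ENNReal.toReal_zero]
  have hle : P.real {ω | a * t < ζ ω v} ≤ P.real {ω | b * t < ζ ω v} +
      (∑ u ∈ Finset.univ.erase v, P.real {ω | ε * t < ζ ω u ∧ a * t < ζ ω v} + 0) := by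
    refine (measureReal_mono hcover (measure_ne_top _ _)).trans ((measureReal_union_le _ _).trans ?_)
    gcongr
    refine (measureReal_union_le _ _).trans (add_le_add (measureReal_biUnion_finset_le _ _) hreal.le)
  have := mul_le_mul_of_nonneg_left hle (show (0 : ℝ) ≤ (t : ℝ) ^ α by positivity)
  rw [mul_add, add_zero, Finset.mul_sum] at this
  linarith

end Core

/-! ### Solving the structural equations along the DAG -/

section Recursion

variable {V : Type*} {G : DAG V}

theorem DAG.wellFounded [Finite V] (G : DAG V) : WellFounded G.Adj := by
  have hirr : Std.Irrefl (Relation.TransGen G.Adj) := ⟨G.acyclic⟩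
  exact Subrelation.wf (fun h => Relation.TransGen.single h)
    (Finite.wellFounded_of_trans_of_irrefl (Relation.TransGen G.Adj))

/-- The solution of the structural equations with structural functions `f`. -/
noncomputable def StructFun.solve [Finite V] (f : StructFun G) (z : V → ℝ≥0) (θ : V → I) :
    V → ℝ≥0 :=
  G.wellFounded.fix fun v ih => f v (fun u : G.pa v => ih u.1 u.2, z v, θ v)

theorem StructFun.solve_eq [Finite V] (f : StructFun G) (z : V → ℝ≥0) (θ : V → I) (v : V) :
    f.solve z θ v = f v (fun u => f.solve z θ u, z v, θ v) :=
  G.wellFounded.fix_eq (C := fun _ => ℝ≥0) _ v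

theorem StructFun.eq_solve [Finite V] {f : StructFun G} {y z : V → ℝ≥0} {θ : V → I}
    (h : ∀ v, y v = f v (fun u => y u, z v, θ v)) : y = f.solve z θ := by
  funext v
  induction v using G.wellFounded.induction with
  | _ v ih =>
    rw [h v, f.solve_eq z θ v]
    congr 3
    funext u
    exact ih u.1 u.2

theorem StructFun.measurable_solve [Finite V] {f : StructFun G} (hf : ∀ v, Measurable (f v)) :
    Measurable fun p : (V → ℝ≥0) × (V → I) => f.solve p.1 p.2 := by
  refine measurable_pi_lambda _ fun v => ?_
  induction v using G.wellFounded.induction with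
  | _ v ih =>
    simp only [f.solve_eq _ _ v]
    exact (hf v).comp ((measurable_pi_lambda _ fun u : G.pa v => ih u.1 u.2).prodMk
      (((measurable_pi_apply v).comp measurable_fst).prodMk
        ((measurable_pi_apply v).comp measurable_snd)))

variable {g f : StructFun G}

theorem AsympHomogeneous.tendsto_prod [Finite V] (h : AsympHomogeneous g f) (v : V) (r : I)
    (y : G.pa v → ℝ≥0) (η : ℝ≥0) :
    Tendsto (fun p : ℝ≥0 × (G.pa v → ℝ≥0) × ℝ≥0 => p.1⁻¹ * g v (p.1 • p.2.1, p.1 * p.2.2, r))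
      (atTop ×ˢ 𝓝 (y, η)) (𝓝 (f v (y, η, r))) :=
  tendsto_prod_of_forall_tendsto
    (Φ := fun t (q : (G.pa v → ℝ≥0) × ℝ≥0) => t⁻¹ * g v (t • q.1, t * q.2, r)) fun x hx =>
    (h v r).2 (fun t => (x t).1) y (fun t => (x t).2) η
      ((continuous_fst.tendsto _).comp hx) ((continuous_snd.tendsto _).comp hx)

/-- For `c ≠ 0`, reparametrise the limit at `(y, η)` by `c * t` and compare with the limit at `(c •
y, c * η)`. For `c = 0` the claim is the normalisation of `f` at the origin. -/
theorem AsympHomogeneous.homogeneous (h : AsympHomogeneous g f) (v : V) (c : ℝ≥0)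
    (y : G.pa v → ℝ≥0) (η : ℝ≥0) (r : I) : f v (c • y, c * η, r) = c * f v (y, η, r) := by
  rcases eq_or_ne c 0 with rfl | hc
  · simp only [zero_smul, zero_mul]
    exact (h v r).1
  have h1 := (h v r).2 (fun _ => c • y) (c • y) (fun _ => c * η) (c * η) tendsto_const_nhds
    tendsto_const_nhds
  have h2 := (((h v r).2 (fun _ => y) y (fun _ => η) η tendsto_const_nhds
    tendsto_const_nhds).comp (tendsto_mul_atTop (pos_iff_ne_zero.2 hc))).const_mul c
  refine tendsto_nhds_unique h1 (h2.congr fun t => ?_)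
  simp only [Function.comp_apply]
  rw [mul_inv, ← mul_assoc, mul_inv_cancel_left₀ hc, smul_smul, mul_comm c t, mul_assoc]

/-- Induction along the DAG: the rescaled solutions at the parents converge, and joint convergence
in time and argument is exactly what may be fed into the next structural function. -/
theorem AsympHomogeneous.tendsto_solve [Finite V] (h : AsympHomogeneous g f) (θ : V → I)
    (z : V → ℝ≥0) :
    Tendsto (fun p : ℝ≥0 × (V → ℝ≥0) => p.1⁻¹ • g.solve (p.1 • p.2) θ) (atTop ×ˢ 𝓝 z)
      (𝓝 (f.solve z θ)) := by
  refine tendsto_pi_nhds.2 fun v => ?_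
  induction v using G.wellFounded.induction with
  | _ v ih =>
    have hpa : Tendsto (fun p : ℝ≥0 × (V → ℝ≥0) =>
        fun u : G.pa v => (p.1⁻¹ • g.solve (p.1 • p.2) θ) u) (atTop ×ˢ 𝓝 z)
        (𝓝 fun u : G.pa v => f.solve z θ u) := tendsto_pi_nhds.2 fun u => ih u.1 u.2
    have hz : Tendsto (fun p : ℝ≥0 × (V → ℝ≥0) => p.2 v) (atTop ×ˢ 𝓝 z) (𝓝 (z v)) :=
      ((continuous_apply v).tendsto z).comp tendsto_snd
    have hcomp := (h.tendsto_prod v (θ v) (fun u => f.solve z θ u) (z v)).comp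
      (tendsto_fst.prodMk (hpa.prodMk_nhds hz))
    rw [f.solve_eq z θ v]
    refine hcomp.congr' ?_
    filter_upwards [tendsto_fst.eventually (eventually_gt_atTop (0 : ℝ≥0))] with p hp
    simp only [Function.comp_apply, Pi.smul_apply, smul_eq_mul]
    rw [g.solve_eq (p.1 • p.2) θ v]
    congr 3
    funext u
    simp [mul_inv_cancel_left₀ hp.ne']

theorem AsympHomogeneous.solve_zero [Finite V] (h : AsympHomogeneous g f) (θ : V → I) :
    f.solve 0 θ = 0 :=
  (StructFun.eq_solve fun v => ((h v (θ v)).1).symm).symm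

end Recursion

/-! ### Domination by the largest innovation -/

section Domination

variable {V : Type*} [Fintype V] {G : DAG V}

/-- Each node on the way multiplies the bound by at most `max 1 (a w)`. No factor is repeated, so a
moment of order `α` of each factor will suffice. -/
theorem le_prod_mul_of_forall_le {x z a : V → ℝ≥0}
    (h : ∀ v B, (∀ u : G.pa v, x u ≤ B) → z v ≤ B → x v ≤ a v * B) {B : ℝ≥0}
    (hB : ∀ u, z u ≤ B) (v : V) : x v ≤ (∏ w, max 1 (a w)) * B := by
  classical
  -- The induction runs over products restricted to the ancestors of `v`, itself included. By
  -- acyclicity the ancestors of a parent omit `v`, which leaves room for the new factor.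
  let A : V → Finset V := fun v => Finset.univ.filter fun w => Relation.ReflTransGen G.Adj w v
  have hone : ∀ S : Finset V, 1 ≤ ∏ w ∈ S, max 1 (a w) := fun S =>
    Finset.one_le_prod' fun w _ => le_max_left _ _
  have hmono : ∀ S T : Finset V, S ⊆ T → ∏ w ∈ S, max 1 (a w) ≤ ∏ w ∈ T, max 1 (a w) :=
    fun S T hST => Finset.prod_le_prod_of_subset_of_one_le' hST fun w _ _ => le_max_left _ _
  have key : ∀ v, x v ≤ (∏ w ∈ A v, max 1 (a w)) * B := fun v => by
    induction v using G.wellFounded.induction with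
    | _ v ih =>
      have hv : v ∈ A v := by simp [A, Relation.ReflTransGen.refl]
      rw [← Finset.mul_prod_erase _ _ hv, mul_assoc]
      refine (h v ((∏ w ∈ (A v).erase v, max 1 (a w)) * B) (fun u => ?_) ?_).trans ?_
      · refine (ih u.1 u.2).trans (mul_le_mul_left (hmono _ _ fun w hw => ?_) B)
        have hwu : Relation.ReflTransGen G.Adj w u := by simpa [A] using hw
        have hwv : Relation.TransGen G.Adj w v := Relation.TransGen.tail' hwu u.2
        refine Finset.mem_erase.2 ⟨?_, by simpa [A] using hwv.to_reflTransGen⟩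
        rintro rfl
        exact G.acyclic _ hwv
      · exact (hB v).trans (le_mul_of_one_le_left' (hone _))
      · exact mul_le_mul_left (le_max_right _ _) _
  exact (key v).trans (mul_le_mul_left (hmono _ _ (Finset.subset_univ _)) B)

/-- A seminorm on a finite-dimensional space is convex, hence continuous, hence bounded by a
multiple of the maximum norm. -/
theorem exists_seminorm_bound {ι : Type*} [Finite ι] (N : Seminorm ℝ ((ι → ℝ) × ℝ)) :
    ∃ K : ℝ≥0, ∀ (x : ι → ℝ≥0) (z B : ℝ≥0), (∀ i, x i ≤ B) → z ≤ B →
      N (fun i => (x i : ℝ), (z : ℝ)) ≤ K * B := by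
  have := Fintype.ofFinite ι
  obtain ⟨C, hC, hN⟩ := N.bound_of_continuous_normedSpace
    (continuousOn_univ.1 (N.convexOn.continuousOn isOpen_univ))
  refine ⟨⟨C, hC.le⟩, fun x z B hx hz => (hN _).trans ?_⟩
  refine mul_le_mul_of_nonneg_left ?_ hC.le
  refine norm_prod_le_iff.2 ⟨(pi_norm_le_iff_of_nonneg B.coe_nonneg).2 fun i => ?_, ?_⟩
  · simpa using hx i
  · simpa using hz

/-- The coordinates are independent under `uniformLaw`, so integrability is checked factor by
factor, using `max 1 x ^ α ≤ 1 + x ^ α`. -/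
theorem integrable_prod_max_rpow {α : ℝ} (hα : 0 < α) {C : V → I → ℝ≥0}
    (hC : ∀ v, Measurable (C v)) (hCα : ∀ v, ∫⁻ r : I, (C v r : ℝ≥0∞) ^ α < ∞) (K : V → ℝ≥0) :
    Integrable (fun θ : V → I => ((∏ v, max 1 (K v * C v (θ v)) : ℝ≥0) : ℝ) ^ α)
      (uniformLaw V) := by
  have h1 : ∀ v, Integrable (fun r : I => (C v r : ℝ) ^ α) := fun v => by
    refine ⟨((hC v).coe_nnreal_real.pow_const α).aestronglyMeasurable, ?_⟩
    rw [hasFiniteIntegral_iff_enorm]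
    refine lt_of_eq_of_lt (lintegral_congr fun r => ?_) (hCα v)
    rw [Real.enorm_eq_ofReal (by positivity), ← ENNReal.ofReal_rpow_of_nonneg (by positivity) hα.le,
      ENNReal.ofReal_coe_nnreal]
  have h2 : ∀ v, Integrable (fun r : I => ((max 1 (K v * C v r) : ℝ≥0) : ℝ) ^ α) := fun v => by
    refine Integrable.mono' ((integrable_const (1 : ℝ)).add ((h1 v).const_mul ((K v : ℝ) ^ α)))
      ((measurable_const.max ((hC v).const_mul _)).coe_nnreal_real.pow_const
        α).aestronglyMeasurable (Eventually.of_forall fun r => ?_)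
    rw [Real.norm_of_nonneg (by positivity)]
    simp only [Pi.add_apply]
    rw [← Real.mul_rpow (by positivity) (by positivity)]
    rcases le_total 1 (K v * C v r) with h | h
    · rw [max_eq_right h, NNReal.coe_mul]
      linarith
    · rw [max_eq_left h, NNReal.coe_one, Real.one_rpow]
      linarith [show (0 : ℝ) ≤ ((K v : ℝ) * C v r) ^ α by positivity]
  refine (Integrable.fintype_prod h2).congr (Eventually.of_forall fun θ => ?_)
  simp only [NNReal.coe_prod]
  exact Real.finsetProd_rpow _ _ (fun _ _ => NNReal.coe_nonneg _) _

variable {Ω : Type*} [MeasurableSpace Ω] {α : ℝ} {P : Measure Ω} {g : StructFun G}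
  {ζ : Ω → V → ℝ≥0} {θ : Ω → V → I} {X : Ω → V → ℝ≥0}

/-- The components of `X` are dominated by a random multiple of the largest innovation, where the
multiplier depends on `θ` only and has a finite moment of order `α`. -/
theorem exists_dominating (hα : 0 < α)
    (hX_eq : ∀ᵐ ω ∂P, ∀ v, X ω v = g v (fun u => X ω u, ζ ω v, θ ω v))
    (N : ∀ v, Seminorm ℝ ((G.pa v → ℝ) × ℝ))
    (h_dom : ∀ v, ∃ C : I → ℝ≥0, Measurable C ∧ ∫⁻ r : I, (C r : ℝ≥0∞) ^ α < ∞ ∧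
      ∀ᵐ ω ∂P, (g v (fun u => X ω u, ζ ω v, θ ω v) : ℝ) ≤
        C (θ ω v) * N v (fun u => (X ω u : ℝ), (ζ ω v : ℝ))) :
    ∃ D : (V → I) → ℝ≥0, Measurable D ∧ (∀ r, 1 ≤ D r) ∧
      Integrable (fun r => (D r : ℝ) ^ α) (uniformLaw V) ∧
      ∀ᵐ ω ∂P, ∀ v, X ω v ≤ D (θ ω) * Finset.univ.sup (ζ ω) := by
  choose C hC hCα hCX using h_dom
  choose K hK using fun v => exists_seminorm_bound (N v)
  refine ⟨fun r => ∏ v, max 1 (K v * C v (r v)), ?_, fun r => ?_,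
    integrable_prod_max_rpow hα hC hCα K, ?_⟩
  · exact Finset.measurable_prod _ fun v _ =>
      measurable_const.max (((hC v).comp (measurable_pi_apply v)).const_mul _)
  · exact Finset.one_le_prod' fun w _ => le_max_left _ _
  · filter_upwards [hX_eq, eventually_all.2 hCX] with ω hω hdom v
    refine le_prod_mul_of_forall_le (G := G) (fun v B hx hz => ?_)
      (fun u => Finset.le_sup (Finset.mem_univ u)) v
    have h1 : (X ω v : ℝ) ≤ C v (θ ω v) * (K v * B) := by
      rw [hω v]
      exact (hdom v).trans (mul_le_mul_of_nonneg_left (hK v _ _ B hx hz) (NNReal.coe_nonneg _))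
    have h2 : X ω v ≤ C v (θ ω v) * (K v * B) := by exact_mod_cast h1
    rwa [← mul_assoc, mul_comm (C v _)] at h2

end Domination

/-! ### Test functions and measures on the punctured orthant -/

section Punctured

variable {V : Type*} [Fintype V]

theorem measurableSet_ne_zero : MeasurableSet {y : V → ℝ≥0 | y ≠ 0} :=
  (measurableSet_singleton (0 : V → ℝ≥0)).compl

theorem measurableEmbedding_punctured :
    MeasurableEmbedding (Subtype.val : Punctured V → V → ℝ≥0) :=
  MeasurableEmbedding.subtype_coe measurableSet_ne_zero

theorem SeparatedFromZero.exists_lt {B : Set (Punctured V)} (hB : SeparatedFromZero B) :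
    ∃ ε : ℝ≥0, 0 < ε ∧ ∀ p ∈ B, ∃ v, ε < p.1 v := by
  obtain ⟨ρ, hρ, hball⟩ := Metric.mem_nhds_iff.1
    (isClosed_closure.isOpen_compl.mem_nhds (show (0 : V → ℝ≥0) ∈ _ from hB))
  refine ⟨⟨ρ / 2, by positivity⟩, by exact_mod_cast half_pos hρ, fun p hp => ?_⟩
  by_contra! hcon
  refine hball (Metric.mem_ball.2 ?_ : p.1 ∈ Metric.ball 0 ρ) (subset_closure ⟨p, hp, rfl⟩)
  refine lt_of_le_of_lt ((dist_pi_le_iff (half_pos hρ).le).2 fun v => ?_) (half_lt_self hρ)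
  have h1 : (p.1 v : ℝ) ≤ ρ / 2 := not_lt.1 (hcon v)
  simpa [NNReal.dist_eq] using h1

/-- Extension by zero of a function on the punctured orthant. -/
noncomputable def extendByZero (H : Punctured V → ℝ) (x : V → ℝ≥0) : ℝ :=
  open Classical in if h : x ≠ 0 then H ⟨x, h⟩ else 0

theorem extendByZero_coe (H : Punctured V → ℝ) (p : Punctured V) : extendByZero H p.1 = H p := by
  rw [extendByZero, dif_pos p.2]

theorem extendByZero_zero (H : Punctured V → ℝ) : extendByZero H 0 = 0 := by
  simp [extendByZero]

theorem abs_extendByZero_le (H : Punctured V →ᵇ ℝ) (x : V → ℝ≥0) : |extendByZero H x| ≤ ‖H‖ := by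
  rcases eq_or_ne x 0 with rfl | hx
  · simp [extendByZero_zero]
  · rw [extendByZero_coe H ⟨x, hx⟩]
    exact H.norm_coe_le_norm _

theorem exists_extendByZero_eq_zero {H : Punctured V → ℝ}
    (hH : SeparatedFromZero (Function.support H)) :
    ∃ ε : ℝ≥0, 0 < ε ∧ ∀ x, (∀ v, x v ≤ ε) → extendByZero H x = 0 := by
  obtain ⟨ε, hε, hB⟩ := hH.exists_lt
  refine ⟨ε, hε, fun x hx => ?_⟩
  rcases eq_or_ne x 0 with rfl | hx0
  · exact extendByZero_zero H
  rw [extendByZero_coe H ⟨x, hx0⟩]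
  by_contra hne
  obtain ⟨v, hv⟩ := hB ⟨x, hx0⟩ hne
  exact (hx v).not_gt hv

theorem continuous_extendByZero {H : Punctured V → ℝ} (hc : Continuous H)
    (hH : SeparatedFromZero (Function.support H)) : Continuous (extendByZero H) := by
  obtain ⟨ε, hε, hzero⟩ := exists_extendByZero_eq_zero hH
  refine continuous_iff_continuousAt.2 fun x => ?_
  rcases eq_or_ne x 0 with rfl | hx
  · have h1 : ∀ᶠ y : V → ℝ≥0 in 𝓝 0, ∀ v, y v ≤ ε := eventually_all.2 fun v =>
      ((continuous_apply v).tendsto (0 : V → ℝ≥0)).eventually (Iic_mem_nhds hε)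
    refine ContinuousAt.congr (f := fun _ => 0) continuousAt_const ?_
    filter_upwards [h1] with y hy using (hzero y hy).symm
  · have hopen : IsOpen {y : V → ℝ≥0 | y ≠ 0} := isOpen_ne
    have h2 := (hopen.isOpenEmbedding_subtypeVal.continuousAt_iff (g := extendByZero H)
      (x := ⟨x, hx⟩)).1
    refine h2 ?_
    exact (hc.continuousAt (x := ⟨x, hx⟩)).congr
      (Eventually.of_forall fun p => (extendByZero_coe H p).symm)

theorem integral_puncture (H : Punctured V → ℝ) (m : Measure (V → ℝ≥0)) :
    ∫ y, H y ∂puncture m = ∫ x, extendByZero H x ∂m := by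
  have h1 := integral_subtype_comap (μ := m) measurableSet_ne_zero (extendByZero H)
  rw [setIntegral_eq_integral_of_forall_compl_eq_zero] at h1
  · rw [← h1]
    exact integral_congr_ae (Eventually.of_forall fun p => (extendByZero_coe H p).symm)
  · intro x hx
    rw [not_not.1 hx, extendByZero_zero]

/-- Needed for `Λ^⊥`, so that Fubini applies to its product with the noise law. -/
theorem sFinite_puncture (m : Measure (V → ℝ≥0)) [SFinite m] : SFinite (puncture m) := by
  refine ⟨fun n => puncture (sfiniteSeq m n), fun n => ?_, ?_⟩
  · refine ⟨?_⟩
    exact (measurableEmbedding_punctured.comap_apply _ _).trans_lt (measure_lt_top _ _)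
  · ext B hB
    rw [Measure.sum_apply _ hB]
    simp only [puncture, measurableEmbedding_punctured.comap_apply]
    conv_lhs => rw [← sum_sfiniteSeq m]
    exact Measure.sum_apply _ (measurableEmbedding_punctured.measurableSet_image.2 hB)

theorem boundedlyFinite_puncture (m : Measure (V → ℝ≥0)) [IsFiniteMeasure m] :
    BoundedlyFinite (puncture m) := fun B _ _ => by
  rw [puncture, measurableEmbedding_punctured.comap_apply]
  exact measure_lt_top _ _

end Punctured

/-! ### Integration against `Λ^⊥` -/

section LambdaPerp

variable {V : Type*} [Fintype V] [DecidableEq V] {α s : ℝ}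

instance : SFinite (lambdaPerp V α s) := sFinite_puncture _

theorem lambdaPerp_exists_lt_le (hα : 0 < α) (hs : 0 < s) {c : ℝ≥0} (hc : 0 < c) :
    lambdaPerp V α s {p | ∃ v, c < p.1 v} ≤
      ENNReal.ofReal (Fintype.card V * (s * (c : ℝ) ^ (-α))) := by
  have hset : {p : Punctured V | ∃ v, c < p.1 v} = ⋃ v, {p | c < p.1 v} := by
    ext p
    simp
  rw [hset]
  refine (measure_iUnion_fintype_le _ _).trans_eq ?_
  simp only [lambdaPerp_tail hα hs _ hc, Finset.sum_const, Finset.card_univ, nsmul_eq_mul]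
  rw [ENNReal.ofReal_mul (p := (Fintype.card V : ℝ)) (by positivity), ENNReal.ofReal_natCast]

theorem ae_lambdaPerp {p : (V → ℝ≥0) → Prop} (hp : MeasurableSet {x | p x})
    (h : ∀ v r, p (Pi.single v r)) : ∀ᵐ y ∂lambdaPerp V α s, p y.1 := by
  rw [ae_iff, lambdaPerp, puncture, measurableEmbedding_punctured.comap_apply]
  refine measure_mono_null (t := {x | ¬ p x}) ?_ ?_
  · rintro _ ⟨y, hy, rfl⟩
    exact hy
  have hc : MeasurableSet {x | ¬ p x} := hp.compl
  rw [Measure.sum_apply _ hc, ENNReal.tsum_eq_zero]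
  intro v
  rw [Measure.map_apply (continuous_axis v).measurable hc]
  have : (fun r : ℝ≥0 => (Pi.single v r : V → ℝ≥0)) ⁻¹' {x | ¬ p x} = ∅ := by
    ext r
    simp [h v r]
  rw [this, measure_empty]

theorem integrable_improperPareto (hα : 0 < α) (hs : 0 < s) {φ : ℝ≥0 → ℝ} (hφ : Measurable φ)
    {M : ℝ} (hM : ∀ r, |φ r| ≤ M) {δ : ℝ≥0} (hδ : 0 < δ) (hφ0 : ∀ r ≤ δ, φ r = 0) :
    Integrable φ (improperPareto α s) := by
  rw [← integrableOn_iff_integrable_of_support_subset (s := Set.Ioi δ)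
    (fun r hr => not_le.1 fun hle => hr (hφ0 r hle))]
  refine Measure.integrableOn_of_bounded ?_ hφ.aestronglyMeasurable (Eventually.of_forall hM)
  rw [improperPareto_Ioi hα hs hδ]
  exact ENNReal.ofReal_ne_top

theorem integral_lambdaPerp (hα : 0 < α) (hs : 0 < s) {h : (V → ℝ≥0) → ℝ} (hh : Measurable h)
    {M : ℝ} (hM : ∀ z, |h z| ≤ M) {δ : ℝ≥0} (hδ : 0 < δ)
    (hzero : ∀ v, ∀ r ≤ δ, h (Pi.single v r) = 0) :
    ∫ p, h p.1 ∂lambdaPerp V α s = ∑ v, ∫ r, h (Pi.single v r) ∂improperPareto α s := by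
  have hm : ∀ v : V, Measurable fun r : ℝ≥0 => (Pi.single v r : V → ℝ≥0) := fun v =>
    (continuous_axis v).measurable
  have h1 := integral_subtype_comap (μ := Measure.sum fun v : V =>
    (improperPareto α s).map fun r => (Pi.single v r : V → ℝ≥0)) measurableSet_ne_zero h
  rw [Measure.restrict_eq_self_of_ae_mem] at h1
  · refine h1.trans ?_
    rw [Measure.sum_fintype, integral_finsetSum_measure]
    · exact Finset.sum_congr rfl fun v _ => integral_map (hm v).aemeasurable hh.aestronglyMeasurable
    · intro v _
      rw [integrable_map_measure hh.aestronglyMeasurable (hm v).aemeasurable]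
      exact integrable_improperPareto hα hs (hh.comp (hm v)) (fun r => hM _) hδ (hzero v)
  -- Puncturing loses no mass, since the improper Pareto measure has no atom at zero.
  · have hc : MeasurableSet {x : V → ℝ≥0 | x ∉ {y : V → ℝ≥0 | y ≠ 0}} :=
      measurableSet_ne_zero.compl
    rw [ae_iff, Measure.sum_apply _ hc, ENNReal.tsum_eq_zero]
    intro v
    rw [Measure.map_apply (hm v) hc]
    refine measure_mono_null (fun r hr => ?_) (improperPareto_singleton_zero (α := α) (s := s))
    simpa using hr

end LambdaPerp

/-! ### From asymptotic equivalence and conditional tails to `AxisTails` -/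

section Hypotheses

variable {V : Type*} {α s : ℝ} {Ω : Type*} [MeasurableSpace Ω] {P : Measure Ω}
  [IsProbabilityMeasure P] {ζ : Ω → V → ℝ≥0}

theorem AxisTails.of_isEquivalent (hs : 0 < s) (hζ : Measurable ζ)
    (hζ_tail : ∀ v, (fun x : ℝ => P.real {ω | x < ζ ω v}) ~[atTop] fun x => s * x ^ (-α))
    (hζ_indep : ∀ u v, u ≠ v →
      Tendsto (fun x : ℝ => P[|{ω | x < ζ ω v}] {ω | x < ζ ω u}) atTop (𝓝 0)) :
    AxisTails α s P ζ := by
  have hcoe : Tendsto (fun t : ℝ≥0 => (t : ℝ)) atTop atTop :=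
    NNReal.tendsto_coe_atTop.2 tendsto_id
  have htail : ∀ v, Tendsto (fun t : ℝ≥0 => (t : ℝ) ^ α * P.real {ω | t < ζ ω v}) atTop
      (𝓝 s) := fun v => by
    have h1 : ∀ᶠ x : ℝ in atTop, s * x ^ (-α) ≠ 0 := by
      filter_upwards [eventually_gt_atTop 0] with x hx
      positivity
    have h2 := (((isEquivalent_iff_tendsto_one h1).1 (hζ_tail v)).comp hcoe).const_mul s
    rw [mul_one] at h2
    refine h2.congr' ?_
    filter_upwards [eventually_gt_atTop 0] with t ht
    have ht' : (0 : ℝ) < t := ht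
    simp only [Function.comp_apply, Pi.div_apply, NNReal.coe_lt_coe]
    rw [Real.rpow_neg ht'.le]
    field_simp
  refine ⟨hζ, htail, fun u v huv => ?_⟩
  have h3 := ((ENNReal.tendsto_toReal ENNReal.zero_ne_top).comp (hζ_indep u v huv)).comp hcoe
  have h4 := (htail v).mul h3
  rw [ENNReal.toReal_zero, mul_zero] at h4
  refine h4.congr fun t => ?_
  have hA : MeasurableSet {ω | t < ζ ω v} :=
    measurableSet_lt measurable_const ((measurable_pi_apply v).comp hζ)
  have hAB : {ω | t < ζ ω v} ∩ {ω | t < ζ ω u} = {ω | t < ζ ω u ∧ t < ζ ω v} :=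
    Set.inter_comm _ _
  have h5 := measureReal_cond (μ := P) hA {ω | t < ζ ω u}
  rw [hAB, Measure.real] at h5
  simp only [Function.comp_apply, NNReal.coe_lt_coe]
  rw [h5, mul_assoc]
  congr 1
  -- Conditioning on a null event gives the zero measure, and the joint event is then null as well.
  by_cases h0 : P.real {ω | t < ζ ω v} = 0
  · rw [h0, zero_mul]
    refine (le_antisymm ?_ measureReal_nonneg).symm
    exact (measureReal_mono (fun ω hω => hω.2) (measure_ne_top _ _)).trans h0.le
  · rw [mul_inv_cancel_left₀ h0]

end Hypotheses

/-! ### Convergence for frozen noise -/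

section FixedNoise

variable {V : Type*} [Fintype V] {G : DAG V} {α s : ℝ} {Ω : Type*}
  [MeasurableSpace Ω] {P : Measure Ω} [IsProbabilityMeasure P] {ζ : Ω → V → ℝ≥0}
  {g f : StructFun G}

theorem continuous_univ_sup : Continuous fun z : V → ℝ≥0 => Finset.univ.sup z :=
  Continuous.finset_sup_apply fun v _ => continuous_apply v

theorem sup_smul_eq (t : ℝ≥0) (z : V → ℝ≥0) :
    Finset.univ.sup (t • z) = t * Finset.univ.sup z := (NNReal.mul_finset_sup t _ z).symm

theorem sup_single [DecidableEq V] (v : V) (x : ℝ≥0) :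
    Finset.univ.sup (Pi.single v x : V → ℝ≥0) = x := by
  refine le_antisymm (Finset.sup_le fun u _ => ?_) ?_
  · by_cases huv : u = v
    · subst huv
      simp
    · simp [huv]
  · simpa using Finset.le_sup (f := (Pi.single v x : V → ℝ≥0)) (Finset.mem_univ v)

/-- The hypothesis concerns only values taken by `ζ`. If the bound failed at an axis point,
continuous convergence would make it fail for `g.solve` on a neighbourhood at all large scales, and
the scaled innovations enter that neighbourhood with positive probability. -/
theorem AxisTails.solve_single_le [DecidableEq V] (hζ : AxisTails α s P ζ) (hα : 0 < α) (hs : 0 < s)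
    (h : AsympHomogeneous g f) {r : V → I} {d : ℝ≥0}
    (hd : ∀ᵐ ω ∂P, ∀ v, g.solve (ζ ω) r v ≤ d * Finset.univ.sup (ζ ω)) (v : V) (x : ℝ≥0) (w : V) :
    f.solve (Pi.single v x) r w ≤ d * x := by
  rcases eq_or_ne x 0 with rfl | hx
  · simp [h.solve_zero]
  by_contra! hcon
  have h1 : Tendsto (fun p : ℝ≥0 × (V → ℝ≥0) => (p.1⁻¹ • g.solve (p.1 • p.2) r) w)
      (atTop ×ˢ 𝓝 (Pi.single v x)) (𝓝 (f.solve (Pi.single v x) r w)) :=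
    tendsto_pi_nhds.1 (h.tendsto_solve r (Pi.single v x)) w
  have h2 : Tendsto (fun p : ℝ≥0 × (V → ℝ≥0) => d * Finset.univ.sup p.2)
      (atTop ×ˢ 𝓝 (Pi.single v x)) (𝓝 (d * x)) := by
    have := ((continuous_univ_sup.tendsto (Pi.single v x : V → ℝ≥0)).comp
      (tendsto_snd (f := (atTop : Filter ℝ≥0)))).const_mul d
    rwa [sup_single] at this
  obtain ⟨pa, hpa, pb, hpb, hp⟩ := eventually_prod_iff.1 (h2.eventually_lt h1 hcon)
  obtain ⟨t, ht, htP, ht0⟩ := (hpa.and ((hζ.eventually_measure_pos hα hs v (pos_iff_ne_zero.2 hx)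
    (show {z | pb z} ∈ 𝓝 (Pi.single v x) from hpb)).and (eventually_gt_atTop 0))).exists
  refine htP (measure_eq_zero_iff_ae_notMem.2 ?_)
  filter_upwards [hd] with ω hω hU
  have h3 := hp ht (show pb (t⁻¹ • ζ ω) from hU)
  simp only [smul_inv_smul₀ ht0.ne', sup_smul_eq, Pi.smul_apply, smul_eq_mul] at h3
  rw [mul_left_comm] at h3
  exact (mul_le_mul_right (hω w) t⁻¹).not_gt h3

variable {F : (V → ℝ≥0) → ℝ} {M : ℝ} {ε : ℝ≥0}

theorem AxisTails.tendsto_integral_solve_fixed [DecidableEq V] (hζ : AxisTails α s P ζ) (hα : 0 < α)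
    (hs : 0 < s) (h : AsympHomogeneous g f) (hg : ∀ v, Measurable (g v)) {r : V → I} {d : ℝ≥0}
    (hd1 : 0 < d) (hd : ∀ᵐ ω ∂P, ∀ v, g.solve (ζ ω) r v ≤ d * Finset.univ.sup (ζ ω))
    (hF : Continuous F) (hM : ∀ x, |F x| ≤ M) (hε : 0 < ε) (hFε : ∀ x, (∀ v, x v ≤ ε) → F x = 0) :
    Tendsto (fun t : ℝ≥0 => (t : ℝ) ^ α * ∫ ω, F (t⁻¹ • g.solve (ζ ω) r) ∂P) atTop
      (𝓝 (∫ p, F (f.solve p.1 r) ∂lambdaPerp V α s)) := by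
  -- Innovations up to `ε / d * t` give solutions up to `ε * t`, where `F` vanishes after rescaling.
  have hδ : 0 < ε / d := div_pos hε hd1
  have hlim : ∀ z, Tendsto (fun p : ℝ≥0 × (V → ℝ≥0) => F (p.1⁻¹ • g.solve (p.1 • p.2) r))
      (atTop ×ˢ 𝓝 z) (𝓝 (F (f.solve z r))) := fun z =>
    (hF.tendsto _).comp (h.tendsto_solve r z)
  have hcont : Continuous fun z => F (f.solve z r) :=
    continuous_of_tendsto_prod (h := fun (t : ℝ≥0) z => F (t⁻¹ • g.solve (t • z) r)) hlim
  have hzero₀ : ∀ v, ∀ x ≤ ε / d, F (f.solve (Pi.single v x) r) = 0 := fun v x hx =>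
    hFε _ fun w => (hζ.solve_single_le hα hs h hd v x w).trans
      ((mul_comm d x).trans_le ((le_div_iff₀ hd1).1 hx))
  have hmeas : ∀ t : ℝ≥0, Measurable fun z => F (t⁻¹ • g.solve (t • z) r) := fun t => by
    have h1 : Measurable fun z : V → ℝ≥0 => (t • z, r) :=
      (continuous_const_smul t).measurable.prodMk measurable_const
    exact hF.measurable.comp ((continuous_const_smul t⁻¹).measurable.comp
      ((StructFun.measurable_solve hg).comp h1))
  have hlimit := hζ.tendsto_integral hα hs (h := fun t z => F (t⁻¹ • g.solve (t • z) r))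
    (h₀ := fun z => F (f.solve z r)) hmeas (fun t z => hM _) (fun z => hM _) hlim hδ ?_ hzero₀
  · rw [integral_lambdaPerp hα hs hcont.measurable (fun z => hM _) hδ hzero₀]
    refine hlimit.congr' ?_
    filter_upwards [eventually_gt_atTop 0] with t ht
    simp only [smul_inv_smul₀ ht.ne']
  · filter_upwards [eventually_gt_atTop 0] with t ht
    filter_upwards [hd] with ω hω hle
    rw [smul_inv_smul₀ ht.ne']
    refine hFε _ fun w => ?_
    have h1 : Finset.univ.sup (ζ ω) ≤ ε / d * t := Finset.sup_le fun v _ => hle v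
    calc t⁻¹ * g.solve (ζ ω) r w ≤ t⁻¹ * (d * (ε / d * t)) := by
          gcongr
          exact (hω w).trans (by gcongr)
      _ = ε := by field_simp

/-- The integrand vanishes almost surely unless some innovation exceeds `ε / d * t`, and a union
bound applies. The dependence on the frozen noise is only through `d ^ α`, which is what dominated
convergence needs. -/
theorem abs_rpow_mul_integral_solve_le {K : ℝ}
    (hK : ∀ v, ∀ t : ℝ≥0, (t : ℝ) ^ α * P.real {ω | t < ζ ω v} ≤ K) (hζ : Measurable ζ)
    {r : V → I} {d : ℝ≥0}
    (hd1 : 0 < d) (hd : ∀ᵐ ω ∂P, ∀ v, g.solve (ζ ω) r v ≤ d * Finset.univ.sup (ζ ω))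
    (hM : ∀ x, |F x| ≤ M) (hε : 0 < ε) (hFε : ∀ x, (∀ v, x v ≤ ε) → F x = 0) {t : ℝ≥0}
    (ht : 0 < t) :
    |(t : ℝ) ^ α * ∫ ω, F (t⁻¹ • g.solve (ζ ω) r) ∂P| ≤
      M * Fintype.card V * K * (ε : ℝ) ^ (-α) * (d : ℝ) ^ α := by
  have hM0 : 0 ≤ M := (abs_nonneg _).trans (hM 0)
  have hc : 0 < ε / d := div_pos hε hd1
  have htα : (0 : ℝ) ≤ (t : ℝ) ^ α := by positivity
  have hms : ∀ v, MeasurableSet {ω | ε / d * t < ζ ω v} := fun v =>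
    measurableSet_lt measurable_const ((measurable_pi_apply v).comp hζ)
  have hpt : ∀ᵐ ω ∂P, ‖F (t⁻¹ • g.solve (ζ ω) r)‖ ≤
      ∑ v, {ω | ε / d * t < ζ ω v}.indicator (fun _ => M) ω := by
    filter_upwards [hd] with ω hω
    have hnn : ∀ v ∈ Finset.univ, 0 ≤ {ω | ε / d * t < ζ ω v}.indicator (fun _ => M) ω :=
      fun v _ => Set.indicator_nonneg (fun _ _ => hM0) _
    by_cases hex : ∃ v, ε / d * t < ζ ω v
    · obtain ⟨v, hv⟩ := hex
      have h1 := Finset.single_le_sum hnn (Finset.mem_univ v)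
      rw [Set.indicator_of_mem (show ω ∈ {ω | ε / d * t < ζ ω v} from hv)] at h1
      exact (hM _).trans h1
    · push Not at hex
      rw [hFε, norm_zero]
      · exact Finset.sum_nonneg hnn
      · intro w
        have h1 : Finset.univ.sup (ζ ω) ≤ ε / d * t := Finset.sup_le fun v _ => hex v
        calc t⁻¹ * g.solve (ζ ω) r w ≤ t⁻¹ * (d * (ε / d * t)) := by
              gcongr
              exact (hω w).trans (by gcongr)
          _ = ε := by field_simp
  have hI : ∀ v, Integrable ({ω | ε / d * t < ζ ω v}.indicator fun _ => M) P := fun v =>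
    (integrable_const M).indicator (hms v)
  have h1 := norm_integral_le_of_norm_le (integrable_finsetSum _ fun v _ => hI v) hpt
  rw [integral_finsetSum _ fun v _ => hI v] at h1
  simp only [integral_indicator_const _ (hms _), smul_eq_mul, Real.norm_eq_abs] at h1
  rw [abs_mul, abs_of_nonneg htα]
  refine (mul_le_mul_of_nonneg_left h1 htα).trans ?_
  rw [Finset.mul_sum]
  have h2 : ∀ v ∈ Finset.univ, (t : ℝ) ^ α * (P.real {ω | ε / d * t < ζ ω v} * M) ≤
      ((ε / d : ℝ≥0) : ℝ) ^ (-α) * K * M := fun v _ => by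
    rw [← mul_assoc, rpow_mul_scale hc α t, mul_assoc (((ε / d : ℝ≥0) : ℝ) ^ (-α))]
    gcongr
    exact hK v _
  refine (Finset.sum_le_sum h2).trans_eq ?_
  rw [Finset.sum_const, Finset.card_univ, nsmul_eq_mul, NNReal.coe_div,
    Real.div_rpow ε.coe_nonneg d.coe_nonneg, Real.rpow_neg d.coe_nonneg, div_inv_eq_mul]
  ring

end FixedNoise

/-! ### Integrating out the noise -/

section RandomNoise

variable {V : Type*} [Fintype V] {G : DAG V} {α s : ℝ} {f : StructFun G}

instance : IsProbabilityMeasure (uniformLaw V) := by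
  unfold uniformLaw
  infer_instance

theorem measurableSet_exists_lt {A : Type*} [MeasurableSpace A] {y : A → V → ℝ≥0}
    (hy : Measurable y) (ε : ℝ≥0) : MeasurableSet {a | ∃ v, ε < y a v} := by
  simp only [Set.ofPred_exists]
  exact MeasurableSet.iUnion fun v =>
    measurableSet_lt measurable_const ((measurable_pi_apply v).comp hy)

theorem measurable_solve_punctured (hf : ∀ v, Measurable (f v)) :
    Measurable fun q : Punctured V × (V → I) => f.solve q.1.1 q.2 :=
  (StructFun.measurable_solve hf).comp
    ((measurable_subtype_coe.comp measurable_fst).prodMk measurable_snd)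

/-- On the slice at `r` the event requires a coordinate above `ε / D r`, which has `Λ^⊥`-mass at
most a constant times `D r ^ α`, and this is integrable in `r`. -/
theorem measure_exists_lt_solve_lt_top [DecidableEq V] (hα : 0 < α) (hs : 0 < s)
    (hf : ∀ v, Measurable (f v)) {D : (V → I) → ℝ≥0} (hD1 : ∀ r, 1 ≤ D r)
    (hDint : Integrable (fun r => (D r : ℝ) ^ α) (uniformLaw V))
    (hD : ∀ᵐ r ∂uniformLaw V, ∀ v x w, f.solve (Pi.single v x) r w ≤ D r * x) {ε : ℝ≥0}
    (hε : 0 < ε) :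
    ((lambdaPerp V α s).prod (uniformLaw V)) {q | ∃ v, ε < f.solve q.1.1 q.2 v} < ∞ := by
  have hms := measurableSet_exists_lt (measurable_solve_punctured hf) ε
  rw [Measure.prod_apply_symm hms]
  have hε' : (0 : ℝ) < ε := hε
  have hint : Integrable (fun r => Fintype.card V * (s * ((ε : ℝ) ^ (-α) * (D r : ℝ) ^ α)))
      (uniformLaw V) := ((hDint.const_mul _).const_mul _).const_mul _
  refine lt_of_le_of_lt (lintegral_mono_ae ?_) hint.lintegral_lt_top
  filter_upwards [hD] with r hr
  have hd : 0 < D r := one_pos.trans_le (hD1 r)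
  have hle : ∀ᵐ p ∂lambdaPerp V α s, ∀ w, f.solve p.1 r w ≤ D r * Finset.univ.sup p.1 := by
    refine ae_lambdaPerp (p := fun z => ∀ w, f.solve z r w ≤ D r * Finset.univ.sup z) ?_ ?_
    · simp only [Set.ofPred_forall]
      refine MeasurableSet.iInter fun w => measurableSet_le ((measurable_pi_apply w).comp
        ((StructFun.measurable_solve hf).comp (measurable_id.prodMk measurable_const)))
        (continuous_univ_sup.measurable.const_mul _)
    · intro v x w
      rw [sup_single]
      exact hr v x w
  refine (measure_mono_ae ?_).trans ((lambdaPerp_exists_lt_le hα hs (div_pos hε hd)).trans_eq ?_)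
  · filter_upwards [hle] with p hp
    rintro ⟨w, hw⟩
    have h1 : ε / D r < Finset.univ.sup p.1 :=
      (div_lt_iff₀' hd).2 (lt_of_lt_of_le hw (hp w))
    obtain ⟨v, _, hv⟩ := Finset.lt_sup_iff.1 h1
    exact ⟨v, hv⟩
  · rw [NNReal.coe_div, Real.div_rpow ε.coe_nonneg (D r).coe_nonneg,
      Real.rpow_neg (D r).coe_nonneg, div_inv_eq_mul]

variable {Ω : Type*} [MeasurableSpace Ω] {P : Measure Ω} [IsProbabilityMeasure P]
  {ζ : Ω → V → ℝ≥0} {θ : Ω → V → I} {g : StructFun G}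

theorem map_noise_eq_prod (hζ : Measurable ζ) (hθ : Measurable θ)
    (hθ_law : P.map θ = uniformLaw V) (h_indep : IndepFun ζ θ P) :
    P.map (fun ω => (θ ω, ζ ω)) = (uniformLaw V).prod (P.map ζ) := by
  rw [← hθ_law]
  exact (indepFun_iff_map_prod_eq_prod_map_map hθ.aemeasurable hζ.aemeasurable).1 h_indep.symm

theorem ae_ae_solve_le (hζ : Measurable ζ) (hθ : Measurable θ)
    (hθ_law : P.map θ = uniformLaw V) (h_indep : IndepFun ζ θ P) (hg : ∀ v, Measurable (g v))
    {D : (V → I) → ℝ≥0} (hDm : Measurable D)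
    (hD : ∀ᵐ ω ∂P, ∀ v, g.solve (ζ ω) (θ ω) v ≤ D (θ ω) * Finset.univ.sup (ζ ω)) :
    ∀ᵐ r ∂uniformLaw V, ∀ᵐ ω ∂P, ∀ v, g.solve (ζ ω) r v ≤ D r * Finset.univ.sup (ζ ω) := by
  have hprob : IsProbabilityMeasure (P.map ζ) := Measure.isProbabilityMeasure_map hζ.aemeasurable
  have hms : MeasurableSet {q : (V → I) × (V → ℝ≥0) |
      ∀ v, g.solve q.2 q.1 v ≤ D q.1 * Finset.univ.sup q.2} := by
    simp only [Set.ofPred_forall]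
    exact MeasurableSet.iInter fun v => measurableSet_le
      ((measurable_pi_apply v).comp ((StructFun.measurable_solve hg).comp measurable_swap))
      ((hDm.comp measurable_fst).mul (continuous_univ_sup.measurable.comp measurable_snd))
  have h1 : ∀ᵐ q ∂P.map (fun ω => (θ ω, ζ ω)),
      ∀ v, g.solve q.2 q.1 v ≤ D q.1 * Finset.univ.sup q.2 :=
    (ae_map_iff (hθ.prodMk hζ).aemeasurable hms).2 hD
  rw [map_noise_eq_prod hζ hθ hθ_law h_indep] at h1
  filter_upwards [Measure.ae_ae_of_ae_prod h1] with r hr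
  exact ae_of_ae_map hζ.aemeasurable hr

theorem AxisTails.tendsto_integral_solve [DecidableEq V] (hζ : AxisTails α s P ζ) (hα : 0 < α)
    (hs : 0 < s) (hθ : Measurable θ) (hθ_law : P.map θ = uniformLaw V) (h_indep : IndepFun ζ θ P)
    (hg : ∀ v, Measurable (g v)) (hf : ∀ v, Measurable (f v)) (h : AsympHomogeneous g f)
    {D : (V → I) → ℝ≥0} (hD1 : ∀ r, 1 ≤ D r)
    (hDint : Integrable (fun r => (D r : ℝ) ^ α) (uniformLaw V))
    (hD : ∀ᵐ r ∂uniformLaw V, ∀ᵐ ω ∂P, ∀ v, g.solve (ζ ω) r v ≤ D r * Finset.univ.sup (ζ ω))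
    {F : (V → ℝ≥0) → ℝ} {M : ℝ} {ε : ℝ≥0} (hF : Continuous F) (hM : ∀ x, |F x| ≤ M) (hε : 0 < ε)
    (hFε : ∀ x, (∀ v, x v ≤ ε) → F x = 0) :
    Tendsto (fun t : ℝ≥0 => (t : ℝ) ^ α * ∫ ω, F (t⁻¹ • g.solve (ζ ω) (θ ω)) ∂P) atTop
      (𝓝 (∫ q, F (f.solve q.1.1 q.2) ∂(lambdaPerp V α s).prod (uniformLaw V))) := by
  have hprob : IsProbabilityMeasure (P.map ζ) :=
    Measure.isProbabilityMeasure_map hζ.measurable.aemeasurable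
  have hd0 : ∀ r, 0 < D r := fun r => one_pos.trans_le (hD1 r)
  obtain ⟨K, -, hK⟩ := hζ.exists_bound hα
  have hgm : ∀ t : ℝ≥0, Measurable fun q : (V → I) × (V → ℝ≥0) => F (t⁻¹ • g.solve q.2 q.1) :=
    fun t => hF.measurable.comp ((continuous_const_smul t⁻¹).measurable.comp
      ((StructFun.measurable_solve hg).comp measurable_swap))
  have hinner : ∀ (t : ℝ≥0) (r : V → I), ∫ z, F (t⁻¹ • g.solve z r) ∂P.map ζ =
      ∫ ω, F (t⁻¹ • g.solve (ζ ω) r) ∂P := fun t r =>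
    integral_map hζ.measurable.aemeasurable
      ((hgm t).comp measurable_prodMk_left).aestronglyMeasurable
  have hfubini : ∀ t : ℝ≥0, ∫ ω, F (t⁻¹ • g.solve (ζ ω) (θ ω)) ∂P =
      ∫ r, ∫ ω, F (t⁻¹ • g.solve (ζ ω) r) ∂P ∂uniformLaw V := fun t => by
    have h1 := integral_map (hθ.prodMk hζ.measurable).aemeasurable (μ := P)
      (hgm t).aestronglyMeasurable
    rw [← h1, map_noise_eq_prod hζ.measurable hθ hθ_law h_indep, integral_prod]
    · exact integral_congr_ae (Eventually.of_forall fun r => hinner t r)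
    · exact Integrable.of_bound (hgm t).aestronglyMeasurable M (Eventually.of_forall fun q => hM _)
  have hdct : Tendsto (fun t : ℝ≥0 =>
      ∫ r, (t : ℝ) ^ α * ∫ ω, F (t⁻¹ • g.solve (ζ ω) r) ∂P ∂uniformLaw V) atTop
      (𝓝 (∫ r, ∫ p, F (f.solve p.1 r) ∂lambdaPerp V α s ∂uniformLaw V)) := by
    -- The bound does not depend on `t`, and the pointwise limit is the frozen-noise theorem.
    refine tendsto_integral_filter_of_dominated_convergence
      (fun r => M * Fintype.card V * K * (ε : ℝ) ^ (-α) * (D r : ℝ) ^ α)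
      (Eventually.of_forall fun t => ?_) ?_ (hDint.const_mul _) ?_
    · simp only [← hinner]
      exact ((hgm t).stronglyMeasurable.integral_prod_right'.const_mul _).aestronglyMeasurable
    · filter_upwards [eventually_gt_atTop 0] with t ht
      filter_upwards [hD] with r hr
      exact abs_rpow_mul_integral_solve_le hK hζ.measurable (hd0 r) hr hM hε hFε ht
    · filter_upwards [hD] with r hr
      exact hζ.tendsto_integral_solve_fixed hα hs h hg (hd0 r) hr hF hM hε hFε
  have hm : Measurable fun q : Punctured V × (V → I) => F (f.solve q.1.1 q.2) :=
    hF.measurable.comp (measurable_solve_punctured hf)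
  have hintegrable : Integrable (fun q : Punctured V × (V → I) => F (f.solve q.1.1 q.2))
      ((lambdaPerp V α s).prod (uniformLaw V)) := by
    rw [← integrableOn_iff_integrable_of_support_subset
      (s := {q : Punctured V × (V → I) | ∃ v, ε < f.solve q.1.1 q.2 v})]
    · refine Measure.integrableOn_of_bounded ?_ hm.aestronglyMeasurable
        (Eventually.of_forall fun q => hM _)
      refine (measure_exists_lt_solve_lt_top hα hs hf hD1 hDint ?_ hε).ne
      filter_upwards [hD] with r hr v x w using hζ.solve_single_le hα hs h hr v x w
    · intro q hq
      by_contra hcon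
      refine hq (hFε _ fun v => not_lt.1 fun hv => hcon ⟨v, hv⟩)
  rw [integral_prod_symm _ hintegrable]
  refine hdct.congr fun t => ?_
  rw [hfubini, integral_const_mul]

end RandomNoise

/-! ### The law of the extremal model -/

section Law

variable {V : Type*} [Fintype V] [DecidableEq V] {G : DAG V} {α s : ℝ} {f : StructFun G}
  {Ω' : Type*} [MeasurableSpace Ω'] {μ : Measure Ω'}

theorem ESCM.Y_eq_solve (Y : ESCM G α s f μ) (ω : Ω') : Y.Y ω = f.solve (Y.η ω).1 (Y.θ ω) :=
  StructFun.eq_solve (Y.structural ω)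

/-- The recursion has a unique solution, so the law of `Y` depends only on the joint law of `(η,
θ)`, whatever the underlying space. -/
theorem ESCM.map_Y (Y : ESCM G α s f μ) (hf : ∀ v, Measurable (f v)) :
    μ.map Y.Y = ((lambdaPerp V α s).prod (uniformLaw V)).map fun q => f.solve q.1.1 q.2 := by
  rw [← Y.law_eq, Measure.map_map (measurable_solve_punctured hf)
    (Y.measurable_η.prodMk Y.measurable_θ)]
  congr 1
  funext ω
  exact Y.Y_eq_solve ω

theorem ESCM.boundedlyFinite_law (Y : ESCM G α s f μ) (hf : ∀ v, Measurable (f v))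
    (hfin : ∀ ε : ℝ≥0, 0 < ε →
      ((lambdaPerp V α s).prod (uniformLaw V)) {q | ∃ v, ε < f.solve q.1.1 q.2 v} < ∞) :
    BoundedlyFinite Y.law := by
  intro B _ hB
  obtain ⟨ε, hε, hBε⟩ := hB.exists_lt
  refine lt_of_le_of_lt ?_ (hfin ε hε)
  rw [ESCM.law, puncture, measurableEmbedding_punctured.comap_apply, Y.map_Y hf]
  refine (measure_mono (t := {y | ∃ v, ε < y v}) ?_).trans_eq
    (Measure.map_apply (measurable_solve_punctured hf) (measurableSet_exists_lt measurable_id ε))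
  rintro _ ⟨p, hp, rfl⟩
  exact hBε p hp

end Law

end ExtremalSCM

/-! ### The main theorem -/

open ExtremalSCM in
theorem theorem2p2 {V : Type*} [Fintype V] [DecidableEq V] (G : DAG V)
    {α s : ℝ} (hα : 0 < α) (hs : 0 < s)
    -- the probability space carrying the innovations `ζ`, `θ` and the vector `X`
    {Ω : Type*} [MeasurableSpace Ω] (P : Measure Ω) [IsProbabilityMeasure P]
    (ζ : Ω → V → ℝ≥0) (θ : Ω → V → I) (X : Ω → V → ℝ≥0)
    (hζ : Measurable ζ) (hθ : Measurable θ) (hX : Measurable X)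
    -- `θ` is i.i.d. uniform and independent of `ζ`
    (hθ_law : P.map θ = uniformLaw V) (h_indep : IndepFun ζ θ P)
    -- the components of `ζ` are regularly varying and extremally independent
    (hζ_tail : ∀ v, (fun x : ℝ => P.real {ω | x < ζ ω v}) ~[atTop] fun x => s * x ^ (-α))
    (hζ_indep : ∀ u v, u ≠ v →
      Tendsto (fun x : ℝ => P[|{ω | x < ζ ω v}] {ω | x < ζ ω u}) atTop (𝓝 0))
    -- the structural functions and the structural equations
    (g f : StructFun G) (hg : ∀ v, Measurable (g v)) (hf : ∀ v, Measurable (f v))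
    (hX_eq : ∀ᵐ ω ∂P, ∀ v, X ω v = g v (fun u => X ω u, ζ ω v, θ ω v))
    -- (1) asymptotic homogeneity
    (h_homog : AsympHomogeneous g f)
    -- (2) domination, in arbitrary norms
    (N : ∀ v, Seminorm ℝ ((G.pa v → ℝ) × ℝ)) (hN : ∀ v p, N v p = 0 → p = 0)
    (h_dom : ∀ v, ∃ C : I → ℝ≥0, Measurable C ∧ ∫⁻ r : I, (C r : ℝ≥0∞) ^ α < ∞ ∧
      ∀ᵐ ω ∂P, (g v (fun u => X ω u, ζ ω v, θ ω v) : ℝ) ≤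
        C (θ ω v) * N v (fun u => (X ω u : ℝ), (ζ ω v : ℝ)))
    -- (3) nontrivial components
    (h_pos : ∀ v, 0 < P {ω | 0 < X ω v}) :
    (∀ (v : V) (c : ℝ≥0) (y : G.pa v → ℝ≥0) (η : ℝ≥0) (r : I),
      f v (c • y, c * η, r) = c * f v (y, η, r)) ∧
    ∀ {Ω' : Type*} [MeasurableSpace Ω'] (μ : Measure Ω') (Y : ESCM G α s f μ),
      VagueTendsto (fun t : ℝ≥0 => puncture (t • P.map fun ω => t ^ (-1 / α) • X ω)) atTop
        Y.law := by
  refine ⟨h_homog.homogeneous, fun μ Y => ?_⟩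
  have htails := AxisTails.of_isEquivalent hs hζ hζ_tail hζ_indep
  obtain ⟨D, hDm, hD1, hDint, hDX⟩ := exists_dominating hα hX_eq N h_dom
  have hsolve : ∀ᵐ ω ∂P, X ω = g.solve (ζ ω) (θ ω) :=
    hX_eq.mono fun ω hω => StructFun.eq_solve hω
  have hD : ∀ᵐ r ∂uniformLaw V, ∀ᵐ ω ∂P, ∀ v,
      g.solve (ζ ω) r v ≤ D r * Finset.univ.sup (ζ ω) := by
    refine ae_ae_solve_le hζ hθ hθ_law h_indep hg hDm ?_
    filter_upwards [hsolve, hDX] with ω h1 h2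
    rwa [← h1]
  have hfin : ∀ ε : ℝ≥0, 0 < ε →
      ((lambdaPerp V α s).prod (uniformLaw V)) {q | ∃ v, ε < f.solve q.1.1 q.2 v} < ∞ :=
    fun ε hε => measure_exists_lt_solve_lt_top hα hs hf hD1 hDint
      (hD.mono fun r hr v x w => htails.solve_single_le hα hs h_homog hr v x w) hε
  refine ⟨fun t => boundedlyFinite_puncture _, Y.boundedlyFinite_law hf hfin, fun H hH => ?_⟩
  obtain ⟨ε, hε, hHε⟩ := exists_extendByZero_eq_zero hH
  have hHc := continuous_extendByZero H.continuous hH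
  have hlim := htails.tendsto_integral_solve hα hs hθ hθ_law h_indep hg hf h_homog hD1 hDint hD
    hHc (abs_extendByZero_le H) hε hHε
  have hroot : Tendsto (fun t : ℝ≥0 => t ^ (1 / α)) atTop atTop :=
    NNReal.tendsto_rpow_atTop (by positivity)
  rw [ESCM.law, integral_puncture, Y.map_Y hf,
    integral_map (measurable_solve_punctured hf).aemeasurable hHc.aestronglyMeasurable]
  -- The limit was proved at scale `t` with weight `t ^ α`; substituting `t ^ (1 / α)` for `t` turns
  -- the weight into `t`.
  refine (hlim.comp hroot).congr fun t => ?_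
  have hXm : Measurable fun ω => t ^ (-1 / α) • X ω :=
    (continuous_const_smul (t ^ (-1 / α))).measurable.comp hX
  simp only [Function.comp_apply]
  rw [integral_puncture, integral_smul_nnreal_measure,
    integral_map hXm.aemeasurable hHc.aestronglyMeasurable, ← NNReal.coe_rpow, ← NNReal.rpow_mul,
    one_div_mul_cancel hα.ne', NNReal.rpow_one, NNReal.smul_def, smul_eq_mul, neg_div,
    NNReal.rpow_neg]
  congr 1
  refine integral_congr_ae ?_
  filter_upwards [hsolve] with ω hω
  rw [hω]
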